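/- Let $2\le m\le n$ be integers and set $\nu=n-m$. Let $\mathbf G=(g_{ij})$ be an $m\times n$ random matrix whose entries are i.i.d. standard complex normal random variables (circularly symmetric complex Gaussian, $\mathbb E[g_{ij}]=0$, $\mathbb E[|g_{ij}|^2]=1$, i.e. with density $\pi^{-1}e^{-|z|^2}$ on $\mathbb C$), and let $\alpha_1,\dots,\alpha_m$ be the eigenvalues of $\mathbf G\mathbf G^\dagger$, listed with multiplicity. Let $\phi=\alpha_I$ and $\varphi=\alpha_J$, where $(I,J)$ is an ordered pair of distinct indices chosen uniformly at random from $\{1,\dots,m\}$, independently of $\mathbf G$. Then the joint distribution of $(\phi,\varphi)$ is absolutely continuous with respect to Lebesgue measure on $\mathbb R^2$, with joint PDF equal, for $\phi,\varphi>0$, to the nonnegative function $$p(\phi,\varphi)=\frac{(\phi\varphi)^\nu e^{-(\phi+\varphi)}}{m(m-1)}\sum_{\substack{k,l=0\\k\neq l}}^{m-1}\frac{k!\,l!}{(k+\nu)!\,(l+\nu)!}\Big\{\big[L_k^\nu(\phi)L_l^\nu(\varphi)\big]^2-L_k^\nu(\phi)L_l^\nu(\phi)L_k^\nu(\varphi)L_l^\nu(\varphi)\Big\},$$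 and equal to $0$ elsewhere, where $L_k^\nu(x)=\frac1{k!}e^x x^{-\nu}\frac{d^k}{dx^k}\big(e^{-x}x^{k+\nu}\big)=\sum_{i=0}^k(-1)^i\binom{k+\nu}{k-i}\frac{x^i}{i!}$ is the associated Laguerre polynomial. -/

import Mathlib

open MeasureTheory ProbabilityTheory
open scoped Nat Matrix

/-- The associated Laguerre polynomial `L_k^ν(x) = ∑ᵢ (-1)ⁱ C(k+ν, k-i) xⁱ / i!`. -/
noncomputable def laguerreL (ν k : ℕ) (x : ℝ) : ℝ :=
  ∑ i ∈ Finset.range (k + 1), (-1 : ℝ) ^ i * ((k + ν).choose (k - i) : ℝ) * x ^ i / (i ! : ℝ)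

/-- Rodrigues' formula: `L_k^ν(x) = (1 / k!) eˣ x^{-ν} dᵏ/dxᵏ (e^{-x} x^{k+ν})`. -/
theorem laguerreL_eq_rodrigues (ν k : ℕ) (x : ℝ) (hx : x ≠ 0) :
    laguerreL ν k x = 1 / (k ! : ℝ) * Real.exp x * (x ^ ν)⁻¹ *
      iteratedDeriv k (fun t : ℝ => Real.exp (-t) * t ^ (k + ν)) x := by
  have h1 : ContDiffAt ℝ k (fun t : ℝ => Real.exp (-t)) x := by fun_prop
  have h2 : ContDiffAt ℝ k (fun t : ℝ => t ^ (k + ν)) x := by fun_prop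
  have hexp : ∀ i : ℕ, iteratedDeriv i (fun t : ℝ => Real.exp (-t)) x
      = (-1) ^ i * Real.exp (-x) := by
    intro i
    have := congrFun (iteratedDeriv_exp_const_mul i (-1)) x
    simpa using this
  have hpow : ∀ i : ℕ, iteratedDeriv i (fun t : ℝ => t ^ (k + ν)) x
      = ((k + ν).descFactorial i : ℝ) * x ^ (k + ν - i) := by
    intro i
    rw [iteratedDeriv_pow]
  rw [iteratedDeriv_fun_mul h1 h2, Finset.mul_sum, laguerreL]
  refine Finset.sum_congr rfl fun i hi => ?_
  have hik : i ≤ k := Nat.lt_succ_iff.mp (Finset.mem_range.mp hi)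
  obtain ⟨j, rfl⟩ := Nat.exists_eq_add_of_le hik
  rw [hexp, hpow, Nat.add_sub_cancel_left, Nat.descFactorial_eq_factorial_mul_choose,
    show i + j + ν - j = ν + i by omega, pow_add]
  have hc : (((i + j).choose i : ℕ) : ℝ) * (i ! : ℝ) * (j ! : ℝ) = ((i + j)! : ℝ) := by
    rw [Nat.choose_symm_add]
    exact_mod_cast Nat.add_choose_mul_factorial_mul_factorial i j
  have he : Real.exp x * Real.exp (-x) = 1 := by rw [← Real.exp_add]; simp
  have hi0 : (i ! : ℝ) ≠ 0 := by positivity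
  have hk0 : ((i + j)! : ℝ) ≠ 0 := by positivity
  have hxν : x ^ ν ≠ 0 := pow_ne_zero _ hx
  push_cast
  field_simp
  rw [← hc]
  linear_combination (-((i + j + ν).choose j : ℝ) * ((i + j).choose i : ℝ) * (i ! : ℝ) * (j ! : ℝ)) * he

/-- The standard complex normal distribution `CN(0, 1)`: density `π⁻¹ exp(-|z|²)` with respect to
Lebesgue measure on `ℂ` (mean `0`, `E[|z|²] = 1`, circularly symmetric). -/
noncomputable def complexNormal : Measure ℂ :=
  (volume : Measure ℂ).withDensity
    fun z => ENNReal.ofReal (Real.pi⁻¹ * Real.exp (-‖z‖ ^ 2))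

/-- The eigenvalues of `A A†`, listed with multiplicity, for a complex `m × n` matrix `A`. -/
noncomputable def wishartEigenvalues {m n : ℕ} (A : Matrix (Fin m) (Fin n) ℂ) : Fin m → ℝ :=
  (Matrix.isHermitian_mul_conjTranspose_self A).eigenvalues

/-- The formula for the joint density at `(x, y)`, to be used for `x, y > 0`. -/
noncomputable def eigenvaluePairDensity (m ν : ℕ) (x y : ℝ) : ℝ :=
  (x * y) ^ ν * Real.exp (-(x + y)) / ((m : ℝ) * ((m : ℝ) - 1)) *
    ∑ k ∈ Finset.range m, ∑ l ∈ (Finset.range m).erase k,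
      ((k ! : ℝ) * (l ! : ℝ)) / (((k + ν)! : ℝ) * ((l + ν)! : ℝ)) *
        ((laguerreL ν k x * laguerreL ν l y) ^ 2 -
          laguerreL ν k x * laguerreL ν l x * laguerreL ν k y * laguerreL ν l y)

/-!
The proof first computes the joint density of all eigenvalues
`l₀ < ⋯ < l_{k-1}` of `A A†` for a Gaussian `k × n` matrix `A`, by induction on `k`, and then
integrates out all but two of them.

**Adding a row.** Adding a row `v` to `A` adds a rank-one matrix to `A† A`. In an eigenbasis of
`A† A` the new eigenvalues `μ` are the roots of the secular equation `1 = ∑ i, t i / (z - a i)`,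
where `a = (0, l)` and the weights `t` are the squared moduli of the components of `v`, those along
the kernel being added up (`exists_unitary_prod_X_sub_C_ascEig_cons`). By unitary invariance the
weights are independent, one with a Gamma and the others with an exponential distribution
(`blockWeight_law`). The map from the roots to the weights is a bijection from the `μ` with
`a 0 < μ 0 < a 1 < μ 1 < ⋯` onto the positive vectors (`injOn_secularWeight`,
`exists_interlaces_secularWeight_eq`), with Jacobian determinant `Δ(μ) / Δ(a)` up to sign
(`abs_det_secularJacobian`), where `Δ` is the Vandermonde determinant. This gives the conditional
density of `μ` given `l` (`map_ascEig_cons`). Only one factor `Δ(l)` is left when it is multiplied by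
the density of `l`, and the integral of `Δ(l)` over the box of all `l` interlacing `μ` is `Δ(μ) / k!`
(`lintegral_box_det_vandermonde`). Hence the ordered eigenvalues have a density proportional to
`Δ(μ)² ∏ μᵢ^ν e^{-μᵢ}` (`map_ascEig`).

**Integrating out.** A random pair of distinct indices makes the order of the eigenvalues irrelevant,
so the density may be symmetrized over all permutations (`lintegral_symmetric`). Up to a constant,
`Δ` is the determinant of the Laguerre polynomials `L_j^ν(xᵢ)` (`det_laguerreL`), which are orthogonal
for the Gamma distribution with density `x^ν e^{-x} / ν!` (`integral_laguerreL_mul`). In the expansion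
of the squared determinant as a double sum over permutations `σ`, `τ`, integration over all variables
but the first two leaves the terms with `τ = σ` and `τ = σ ∘ (0 1)` (`integral_det_sq_cons_cons`).
They give the two terms in the braces of the formula for the density.
-/

/-! ### Monic polynomials, Vandermonde determinants and interlacing -/

theorem map_univ_val_eq_of_prod_X_sub_C_eq {R : Type*} [CommRing R] [IsDomain R]
    {ι κ : Type*} [Fintype ι] [Fintype κ] {f : ι → R} {g : κ → R}
    (h : ∏ i, (Polynomial.X - Polynomial.C (f i)) = ∏ i, (Polynomial.X - Polynomial.C (g i))) :
    Multiset.map f Finset.univ.val = Multiset.map g Finset.univ.val := by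
  have := congrArg Polynomial.roots h
  rwa [Finset.prod_eq_multiset_prod, Finset.prod_eq_multiset_prod,
    ← Function.comp_def (fun x => Polynomial.X - Polynomial.C x) f,
    ← Function.comp_def (fun x => Polynomial.X - Polynomial.C x) g,
    ← Multiset.map_map, ← Multiset.map_map,
    Polynomial.roots_multiset_prod_X_sub_C, Polynomial.roots_multiset_prod_X_sub_C] at this

/-- Increasing families with the same monic polynomial agree. -/
theorem eq_of_monotone_of_prod_X_sub_C_eq {R : Type*} [CommRing R] [IsDomain R] [LinearOrder R]
    {N : ℕ} {a b : Fin N → R}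
    (ha : Monotone a) (hb : Monotone b)
    (h : ∏ i, (Polynomial.X - Polynomial.C (a i)) = ∏ i, (Polynomial.X - Polynomial.C (b i))) :
    a = b := by
  have hm := map_univ_val_eq_of_prod_X_sub_C_eq h
  have hl : List.ofFn a = List.ofFn b := by
    refine List.Perm.eq_of_sortedLE ?_ ?_ ?_
    · exact ha.sortedLE_ofFn
    · exact hb.sortedLE_ofFn
    · rw [← Multiset.coe_eq_coe]
      simpa [Fin.univ_def, List.map_ofFn, ← List.ofFn_eq_map] using hm
  exact List.ofFn_injective hl

theorem det_vandermonde_pos {N : ℕ} {x : Fin N → ℝ} (hx : StrictMono x) :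
    0 < (Matrix.vandermonde x).det := by
  rw [Matrix.det_vandermonde]
  exact Finset.prod_pos fun i _ => Finset.prod_pos fun j hj =>
    sub_pos.2 (hx (Finset.mem_Ioi.1 hj))

theorem prod_erase_eq_prod_Iio_mul_prod_Ioi {N : ℕ} (i : Fin N) (f : Fin N → ℝ) :
    ∏ j ∈ Finset.univ.erase i, f j = (∏ j ∈ Finset.Iio i, f j) * ∏ j ∈ Finset.Ioi i, f j := by
  rw [← Finset.prod_union]
  · congr 1
    ext j
    simp
  · rw [Finset.disjoint_left]
    intro j h1 h2
    exact lt_asymm (Finset.mem_Iio.1 h1) (Finset.mem_Ioi.1 h2)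

/-- The squared Vandermonde determinant is the discriminant, up to sign. -/
theorem det_vandermonde_mul_self {N : ℕ} (x : Fin N → ℝ) :
    (Matrix.vandermonde x).det * (Matrix.vandermonde x).det =
      |∏ i, ∏ j ∈ Finset.univ.erase i, (x i - x j)| := by
  have h2 : ∏ i, ∏ j ∈ Finset.Iio i, (x i - x j) = (Matrix.vandermonde x).det := by
    rw [Matrix.det_vandermonde]
    exact Finset.prod_comm' (by simp)
  have h3 : |∏ i, ∏ j ∈ Finset.Ioi i, (x i - x j)| = |(Matrix.vandermonde x).det| := by
    rw [Matrix.det_vandermonde, Finset.abs_prod, Finset.abs_prod]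
    refine Finset.prod_congr rfl fun i _ => ?_
    rw [Finset.abs_prod, Finset.abs_prod]
    exact Finset.prod_congr rfl fun j _ => abs_sub_comm _ _
  rw [Finset.prod_congr rfl fun i _ => prod_erase_eq_prod_Iio_mul_prod_Ioi i _,
    Finset.prod_mul_distrib, abs_mul, h2, h3, ← abs_mul, abs_mul_self]

/-- `a` and `μ` interlace: `a 0 < μ 0 < a 1 < μ 1 < ⋯`. -/
def Interlaces {N : ℕ} (a μ : Fin N → ℝ) : Prop :=
  (∀ i, a i < μ i) ∧ ∀ i j, i < j → μ i < a j

namespace Interlaces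

variable {N : ℕ} {a μ : Fin N → ℝ}

theorem strictMono_left (h : Interlaces a μ) : StrictMono a := fun i j hij =>
  (h.1 i).trans (h.2 i j hij)

theorem strictMono_right (h : Interlaces a μ) : StrictMono μ := fun i j hij =>
  (h.2 i j hij).trans (h.1 j)

end Interlaces

/-! ### The secular equation -/

/-- The weights `t i` for which the secular equation `1 = ∑ i, t i / (z - a i)`, that is
`∏ (z - a i) = ∑ i, t i * ∏_{j ≠ i} (z - a j)`, has the roots `μ`. -/
noncomputable def secularWeight {N : ℕ} (a μ : Fin N → ℝ) (i : Fin N) : ℝ :=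
  -(∏ j, (a i - μ j)) / ∏ j ∈ Finset.univ.erase i, (a i - a j)

section secular

variable {N : ℕ} {a μ : Fin N → ℝ}

theorem secularWeight_pos (h : Interlaces a μ) (i : Fin N) : 0 < secularWeight a μ i := by
  have h0 : secularWeight a μ i =
      (μ i - a i) * ∏ j ∈ Finset.univ.erase i, ((a i - μ j) / (a i - a j)) := by
    rw [secularWeight, ← Finset.mul_prod_erase _ _ (Finset.mem_univ i), Finset.prod_div_distrib]
    ring
  rw [h0]
  refine mul_pos (sub_pos.2 (h.1 i)) (Finset.prod_pos fun j hj => ?_)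
  rcases lt_or_gt_of_ne (Finset.ne_of_mem_erase hj) with hji | hij
  · exact div_pos (sub_pos.2 (h.2 j i hji)) (sub_pos.2 (h.strictMono_left hji))
  · exact div_pos_of_neg_of_neg (sub_neg.2 ((h.strictMono_left hij).trans (h.1 j)))
      (sub_neg.2 (h.strictMono_left hij))

theorem prod_erase_sub_ne_zero (ha : Function.Injective a) (i : Fin N) :
    ∏ j ∈ Finset.univ.erase i, (a i - a j) ≠ 0 :=
  Finset.prod_ne_zero_iff.2 fun _ hj => sub_ne_zero.2 fun h => Finset.ne_of_mem_erase hj (ha h).symm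

theorem sum_mul_prod_erase_eval (t : Fin N → ℝ) (i : Fin N) :
    ∑ l, t l * ∏ j ∈ Finset.univ.erase l, (a i - a j) =
      t i * ∏ j ∈ Finset.univ.erase i, (a i - a j) := by
  refine Finset.sum_eq_single i (fun l _ hl => ?_) (fun h => absurd (Finset.mem_univ i) h)
  rw [Finset.prod_eq_zero (Finset.mem_erase.2 ⟨hl.symm, Finset.mem_univ i⟩) (sub_self _), mul_zero]

open Polynomial in
theorem degree_sum_mul_prod_erase_lt (t : Fin N → ℝ) :
    (∑ i, C (t i) * ∏ j ∈ Finset.univ.erase i, (X - C (a j))).degree < (N : WithBot ℕ) := by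
  refine (degree_sum_le _ _).trans_lt ((Finset.sup_lt_iff (WithBot.bot_lt_coe N)).2 fun i _ => ?_)
  have hN : 0 < N := i.pos
  refine (degree_mul_le _ _).trans_lt ?_
  refine (add_le_add degree_C_le le_rfl).trans_lt ?_
  rw [zero_add, degree_prod]
  simp only [degree_X_sub_C, Finset.sum_const, Finset.card_erase_of_mem (Finset.mem_univ i),
    Finset.card_univ, Fintype.card_fin, nsmul_eq_mul, mul_one]
  exact Nat.cast_lt.2 (Nat.sub_lt hN one_pos)

open Polynomial in
theorem degree_prod_sub_prod_lt (a μ : Fin N → ℝ) :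
    (∏ j, (X - C (a j)) - ∏ j, (X - C (μ j))).degree < (N : WithBot ℕ) := by
  have hd : ∀ b : Fin N → ℝ, (∏ j, (X - C (b j))).degree = (N : WithBot ℕ) := by
    intro b
    rw [degree_prod]
    simp
  have hm : ∀ b : Fin N → ℝ, (∏ j, (X - C (b j))).Monic := fun b =>
    monic_prod_of_monic _ _ fun i _ => monic_X_sub_C _
  rw [← hd a]
  refine degree_sub_lt_left ((hd a).trans (hd μ).symm) (hm a).ne_zero ?_
  rw [(hm a).leadingCoeff, (hm μ).leadingCoeff]

open Polynomial in
/-- The secular polynomial `∏ (z - a i) - ∑ i, t i * ∏_{j ≠ i} (z - a j)` has the roots `μ` exactly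
for the weights `secularWeight a μ`, by Lagrange interpolation at the nodes `a`. -/
theorem prod_X_sub_C_eq_iff (ha : Function.Injective a) (t : Fin N → ℝ) :
    ∏ j, (X - C (μ j)) =
        ∏ j, (X - C (a j)) - ∑ i, C (t i) * ∏ j ∈ Finset.univ.erase i, (X - C (a j)) ↔
      t = secularWeight a μ := by
  have hev : ∀ (s : Fin N → ℝ) (i : Fin N),
      (∏ j, (X - C (a j)) - ∑ l, C (s l) * ∏ j ∈ Finset.univ.erase l, (X - C (a j))).eval (a i) =
      -(s i * ∏ j ∈ Finset.univ.erase i, (a i - a j)) := by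
    intro s i
    simp only [eval_sub, eval_prod, eval_X, eval_C, eval_finsetSum, eval_mul]
    rw [Finset.prod_eq_zero (Finset.mem_univ i) (sub_self _), zero_sub, sum_mul_prod_erase_eval]
  constructor
  · intro h
    funext i
    have := congrArg (Polynomial.eval (a i)) h
    rw [hev, eval_prod] at this
    simp only [eval_sub, eval_X, eval_C] at this
    rw [secularWeight, this, neg_neg, mul_div_cancel_right₀ _ (prod_erase_sub_ne_zero ha i)]
  · rintro rfl
    rw [eq_sub_iff_add_eq, ← eq_sub_iff_add_eq']
    refine Polynomial.eq_of_degrees_lt_of_eval_index_eq (s := Finset.univ) (v := a) ha.injOn ?_ ?_ ?_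
    · simpa using degree_sum_mul_prod_erase_lt (a := a) (secularWeight a μ)
    · simpa using degree_prod_sub_prod_lt a μ
    · intro i _
      have := hev (secularWeight a μ) i
      simp only [eval_sub, eval_prod, eval_X, eval_C, eval_finsetSum, eval_mul] at this ⊢
      rw [sum_mul_prod_erase_eval, secularWeight,
        div_mul_cancel₀ _ (prod_erase_sub_ne_zero ha i),
        Finset.prod_eq_zero (f := fun j => a i - a j) (Finset.mem_univ i) (sub_self _), zero_sub]

open Polynomial in
/-- Comparison of the second-highest coefficients of the secular polynomial. -/
theorem sum_secularWeight (ha : Function.Injective a) :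
    ∑ i, secularWeight a μ i = ∑ i, μ i - ∑ i, a i := by
  rcases N with _ | N
  · simp
  have h := congrArg (fun p => coeff p N) ((prod_X_sub_C_eq_iff (μ := μ) ha _).2 rfl)
  have hc : ∀ b : Fin (N + 1) → ℝ, (∏ j, (X - C (b j))).coeff N = -∑ j, b j := by
    intro b
    have := prod_X_sub_C_coeff_card_pred (Finset.univ : Finset (Fin (N + 1))) b (by simp)
    simpa using this
  have hc' : ∀ i, (C (secularWeight a μ i) * ∏ j ∈ Finset.univ.erase i, (X - C (a j))).coeff N =
      secularWeight a μ i := by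
    intro i
    rw [coeff_C_mul]
    have hm : (∏ j ∈ Finset.univ.erase i, (X - C (a j))).Monic :=
      monic_prod_of_monic _ _ fun i _ => monic_X_sub_C _
    have hd : (∏ j ∈ Finset.univ.erase i, (X - C (a j))).natDegree = N := by
      rw [natDegree_prod_of_monic _ _ fun i _ => monic_X_sub_C _]
      simp
    have := hm.coeff_natDegree
    rw [hd] at this
    rw [this, mul_one]
  simp only [coeff_sub, finsetSum_coeff, hc, hc'] at h
  linarith

/-- The roots of the secular equation are determined by its weights. -/
theorem injOn_secularWeight : Set.InjOn (secularWeight a) {μ | Interlaces a μ} := by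
  intro μ hμ μ' hμ' h
  refine eq_of_monotone_of_prod_X_sub_C_eq hμ.strictMono_right.monotone
    hμ'.strictMono_right.monotone ?_
  rw [(prod_X_sub_C_eq_iff (μ := μ) hμ.strictMono_left.injective _).2 rfl,
    (prod_X_sub_C_eq_iff (μ := μ') hμ.strictMono_left.injective _).2 rfl, h]

theorem neg_one_pow_mul_prod_erase_pos (ha : StrictMono a) (i : Fin N) :
    0 < (-1) ^ (N - 1 - (i : ℕ)) * ∏ j ∈ Finset.univ.erase i, (a i - a j) := by
  have h2 : (-1) ^ (N - 1 - (i : ℕ)) * ∏ j ∈ Finset.Ioi i, (a i - a j) =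
      ∏ j ∈ Finset.Ioi i, (a j - a i) := by
    rw [← Fin.card_Ioi, ← Finset.prod_const, ← Finset.prod_mul_distrib]
    exact Finset.prod_congr rfl fun j _ => by ring
  rw [prod_erase_eq_prod_Iio_mul_prod_Ioi, mul_left_comm, h2]
  exact mul_pos (Finset.prod_pos fun j hj => sub_pos.2 (ha (Finset.mem_Iio.1 hj)))
    (Finset.prod_pos fun j hj => sub_pos.2 (ha (Finset.mem_Ioi.1 hj)))

open Polynomial in
/-- Every family of positive weights occurs: the secular polynomial changes sign between
consecutive nodes, and between the last node and `+∞`. -/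
theorem exists_interlaces_secularWeight_eq (ha : StrictMono a) {t : Fin N → ℝ}
    (ht : ∀ i, 0 < t i) : ∃ μ, Interlaces a μ ∧ secularWeight a μ = t := by
  set p : ℝ[X] := ∏ j, (X - C (a j)) - ∑ i, C (t i) * ∏ j ∈ Finset.univ.erase i, (X - C (a j))
    with hp
  have hdeg : (∏ j, (X - C (a j))).degree = (N : WithBot ℕ) := by
    rw [degree_prod]
    simp
  have hmon : p.Monic := by
    refine Monic.sub_of_left (monic_prod_of_monic _ _ fun i _ => monic_X_sub_C _) ?_
    rw [hdeg]
    exact degree_sum_mul_prod_erase_lt t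
  have hpdeg : p.degree = (N : WithBot ℕ) := by
    rw [hp, degree_sub_eq_left_of_degree_lt, hdeg]
    rw [hdeg]
    exact degree_sum_mul_prod_erase_lt t
  have heval : ∀ i, p.eval (a i) = -(t i * ∏ j ∈ Finset.univ.erase i, (a i - a j)) := by
    intro i
    simp only [hp, eval_sub, eval_prod, eval_X, eval_C, eval_finsetSum, eval_mul]
    rw [Finset.prod_eq_zero (Finset.mem_univ i) (sub_self _), zero_sub, sum_mul_prod_erase_eval]
  have hsign : ∀ i : Fin N, (-1) ^ (N - 1 - (i : ℕ)) * p.eval (a i) < 0 := by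
    intro i
    rw [heval]
    have := mul_pos (ht i) (neg_one_pow_mul_prod_erase_pos ha i)
    nlinarith
  have hroot : ∀ i : Fin N, ∃ x, a i < x ∧ (∀ j, i < j → x < a j) ∧ p.eval x = 0 := by
    intro i
    -- `b` is the next node, or for the last node a point where the leading term dominates
    obtain ⟨b, hb, hb', hbs⟩ : ∃ b, a i < b ∧ (∀ j, i < j → b ≤ a j) ∧
        0 < (-1) ^ (N - 1 - (i : ℕ)) * p.eval b := by
      by_cases h : (i : ℕ) + 1 < N
      · refine ⟨a ⟨i + 1, h⟩, ha (Fin.lt_def.2 (Nat.lt_succ_self _)),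
          fun j hj => ha.monotone (Fin.le_def.2 (Nat.succ_le_of_lt hj)), ?_⟩
        have h1 := hsign ⟨i + 1, h⟩
        have h2 : N - 1 - (i : ℕ) = N - 1 - (i + 1) + 1 := by omega
        rw [h2, pow_succ]
        simp only at h1
        linarith
      · have hpos : 0 < p.degree := by
          rw [hpdeg]
          exact Nat.cast_pos.2 i.pos
        have htop := p.tendsto_atTop_of_leadingCoeff_nonneg hpos
          (by rw [hmon.leadingCoeff]; exact zero_le_one)
        obtain ⟨b, hb1, hb2⟩ := ((htop.eventually_gt_atTop 0).and
          (Filter.eventually_gt_atTop (a i))).exists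
        refine ⟨b, hb2, fun j hj => absurd j.2 ?_, ?_⟩
        · have := Fin.lt_def.1 hj
          omega
        · have : N - 1 - (i : ℕ) = 0 := by omega
          rwa [this, pow_zero, one_mul]
    have hcont : ContinuousOn (fun x => (-1) ^ (N - 1 - (i : ℕ)) * p.eval x) (Set.Icc (a i) b) := by
      fun_prop
    obtain ⟨x, hx, hx0⟩ := intermediate_value_Ioo hb.le hcont ⟨hsign i, hbs⟩
    refine ⟨x, hx.1, fun j hj => hx.2.trans_le (hb' j hj), ?_⟩
    exact (mul_eq_zero.1 hx0).resolve_left (pow_ne_zero _ (by norm_num))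
  choose μ hμ1 hμ2 hμ3 using hroot
  have hI : Interlaces a μ := ⟨hμ1, hμ2⟩
  refine ⟨μ, hI, ((prod_X_sub_C_eq_iff ha.injective t).1 ?_).symm⟩
  rw [← hp]
  have hmon' : (∏ j, (X - C (μ j))).Monic := monic_prod_of_monic _ _ fun i _ => monic_X_sub_C _
  have hdeg' : (∏ j, (X - C (μ j))).degree = (N : WithBot ℕ) := by
    rw [degree_prod]
    simp
  refine Polynomial.eq_of_degree_sub_lt_of_eval_index_eq (s := Finset.univ) (v := μ)
    hI.strictMono_right.injective.injOn ?_ ?_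
  · rw [Finset.card_univ, Fintype.card_fin, ← hdeg']
    refine degree_sub_lt_left (hdeg'.trans hpdeg.symm) hmon'.ne_zero ?_
    rw [hmon'.leadingCoeff, hmon.leadingCoeff]
  · intro i _
    rw [hμ3, eval_prod]
    exact Finset.prod_eq_zero (Finset.mem_univ i) (by simp)

/-- The Jacobian matrix of `secularWeight a` at `μ`. -/
noncomputable def secularJacobian (a μ : Fin N → ℝ) : Matrix (Fin N) (Fin N) ℝ :=
  Matrix.of fun i j => (∏ l ∈ Finset.univ.erase i, (a i - a l))⁻¹ *
    ∏ l ∈ Finset.univ.erase j, (a i - μ l)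

theorem hasFDerivAt_secularWeight (a μ : Fin N → ℝ) :
    HasFDerivAt (secularWeight a) (Matrix.toLin' (secularJacobian a μ)).toContinuousLinearMap μ := by
  rw [hasFDerivAt_pi']
  intro i
  have h1 : ∀ j ∈ (Finset.univ : Finset (Fin N)), HasFDerivAt (fun x : Fin N → ℝ => a i - x j)
      (-(ContinuousLinearMap.proj j : (Fin N → ℝ) →L[ℝ] ℝ)) μ := fun j _ =>
    (hasFDerivAt_apply j μ).const_sub (a i)
  have h2 := ((HasFDerivAt.finsetProd h1).neg).mul_const
    (∏ l ∈ Finset.univ.erase i, (a i - a l))⁻¹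
  refine h2.congr_fderiv ?_
  ext x
  simp only [smul_apply, neg_apply,
    sum_apply, ContinuousLinearMap.proj_apply, smul_eq_mul,
    ContinuousLinearMap.comp_apply, LinearMap.coe_toContinuousLinearMap', Matrix.toLin'_apply,
    Matrix.mulVec, dotProduct, secularJacobian, Matrix.of_apply]
  rw [← Finset.sum_neg_distrib, Finset.mul_sum]
  exact Finset.sum_congr rfl fun j _ => by ring

open Polynomial in
/-- Both matrices `(∏_{l ≠ j} (a i - μ l))` and `(∏_{l ≠ j} (μ i - μ l))`, the second diagonal, are
the product of a Vandermonde matrix with the same matrix of coefficients. -/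
theorem det_prod_erase_mul_det_vandermonde (a μ : Fin N → ℝ) :
    (Matrix.of fun i j => ∏ l ∈ Finset.univ.erase j, (a i - μ l)).det *
        (Matrix.vandermonde μ).det =
      (Matrix.vandermonde a).det * ∏ j, ∏ l ∈ Finset.univ.erase j, (μ j - μ l) := by
  set Q : Fin N → ℝ[X] := fun j => ∏ l ∈ Finset.univ.erase j, (X - C (μ l)) with hQ
  set K : Matrix (Fin N) (Fin N) ℝ := Matrix.of fun l j => (Q j).coeff l with hK
  have hfac : ∀ b : Fin N → ℝ, (Matrix.of fun i j => ∏ l ∈ Finset.univ.erase j, (b i - μ l)) =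
      Matrix.vandermonde b * K := by
    intro b
    ext i j
    have hd : (Q j).natDegree < N := by
      rw [hQ, natDegree_prod_of_monic _ _ fun i _ => monic_X_sub_C _]
      simp only [natDegree_X_sub_C, Finset.sum_const, Finset.card_erase_of_mem (Finset.mem_univ j),
        Finset.card_univ, Fintype.card_fin, smul_eq_mul, mul_one]
      exact Nat.sub_lt j.pos one_pos
    have he : (Q j).eval (b i) = ∏ l ∈ Finset.univ.erase j, (b i - μ l) := by
      simp [hQ, eval_prod]
    rw [Matrix.of_apply, ← he, eval_eq_sum_range' hd, Matrix.mul_apply, ← Fin.sum_univ_eq_sum_range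
      (fun l => (Q j).coeff l * b i ^ l)]
    exact Finset.sum_congr rfl fun l _ => by
      rw [Matrix.vandermonde_apply, hK, Matrix.of_apply, mul_comm]
  have hdiag : (Matrix.of fun i j => ∏ l ∈ Finset.univ.erase j, (μ i - μ l)) =
      Matrix.diagonal fun j => ∏ l ∈ Finset.univ.erase j, (μ j - μ l) := by
    ext i j
    rcases eq_or_ne i j with rfl | hij
    · simp
    · rw [Matrix.diagonal_apply_ne _ hij, Matrix.of_apply]
      exact Finset.prod_eq_zero (Finset.mem_erase.2 ⟨hij, Finset.mem_univ i⟩) (sub_self _)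
  have h2 := congrArg Matrix.det (hdiag.symm.trans (hfac μ))
  rw [Matrix.det_diagonal, Matrix.det_mul] at h2
  rw [hfac a, Matrix.det_mul, h2]
  ring

/-- The Jacobian of the change of variables from the roots of the secular equation to its weights. -/
theorem abs_det_secularJacobian (ha : StrictMono a) (hμ : StrictMono μ) :
    |(Matrix.toLin' (secularJacobian a μ)).toContinuousLinearMap.det| =
      (Matrix.vandermonde μ).det / (Matrix.vandermonde a).det := by
  have hdet : (Matrix.toLin' (secularJacobian a μ)).toContinuousLinearMap.det =
      (secularJacobian a μ).det := by
    rw [ContinuousLinearMap.det, LinearMap.toContinuousLinearMap, LinearEquiv.coe_mk]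
    exact LinearMap.det_toLin' _
  have ha0 := det_vandermonde_pos ha
  have hμ0 := det_vandermonde_pos hμ
  have h1 := congrArg abs (det_prod_erase_mul_det_vandermonde a μ)
  rw [abs_mul, abs_mul, ← det_vandermonde_mul_self, abs_of_pos ha0, abs_of_pos hμ0] at h1
  have h2 : |(Matrix.of fun i j => ∏ l ∈ Finset.univ.erase j, (a i - μ l)).det| =
      (Matrix.vandermonde a).det * (Matrix.vandermonde μ).det := by
    refine mul_right_cancel₀ hμ0.ne' ?_
    rw [h1, mul_assoc]
  rw [hdet, secularJacobian]
  have h3 := Matrix.det_mul_column (fun i => (∏ l ∈ Finset.univ.erase i, (a i - a l))⁻¹)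
    (Matrix.of fun i j => ∏ l ∈ Finset.univ.erase j, (a i - μ l))
  simp only [Matrix.of_apply] at h3
  rw [h3, abs_mul, h2, Finset.prod_inv_distrib, abs_inv, ← det_vandermonde_mul_self]
  field_simp

end secular

/-! ### Product measures -/

section ProductMeasures

variable {E : Type*} [MeasurableSpace E]

theorem measurePreserving_finCons {n : ℕ} (μ : Fin (n + 1) → Measure E) [∀ i, SigmaFinite (μ i)] :
    MeasurePreserving (fun p : E × (Fin n → E) => (Fin.cons p.1 p.2 : Fin (n + 1) → E))
      ((μ 0).prod (Measure.pi fun i : Fin n => μ i.succ)) (Measure.pi μ) := by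
  have h := (measurePreserving_piFinSuccAbove μ 0).symm
  simpa using! h

theorem lintegral_pi_prod {n : ℕ} (μ : Fin n → Measure E) [∀ i, SigmaFinite (μ i)]
    {f : Fin n → E → ENNReal} (hf : ∀ i, Measurable (f i)) :
    ∫⁻ x, ∏ i, f i (x i) ∂Measure.pi μ = ∏ i, ∫⁻ y, f i y ∂μ i := by
  induction n with
  | zero => simp
  | succ n ih =>
    have hm : Measurable fun x : Fin (n + 1) → E => ∏ i, f i (x i) :=
      Finset.measurable_fun_prod _ fun i _ => (hf i).comp (measurable_pi_apply i)
    have hm' : Measurable fun x : Fin n → E => ∏ i : Fin n, f i.succ (x i) :=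
      Finset.measurable_fun_prod _ fun i _ => (hf _).comp (measurable_pi_apply i)
    rw [← (measurePreserving_finCons μ).lintegral_comp hm]
    simp only [Fin.prod_univ_succ, Fin.cons_zero, Fin.cons_succ]
    rw [lintegral_prod_mul (hf 0).aemeasurable hm'.aemeasurable, ih _ fun i => hf i.succ]

theorem pi_withDensity {n : ℕ} (μ : Fin n → Measure E) [∀ i, SigmaFinite (μ i)]
    {f : Fin n → E → ENNReal} (hf : ∀ i, Measurable (f i))
    [∀ i, SigmaFinite ((μ i).withDensity (f i))] :
    Measure.pi (fun i => (μ i).withDensity (f i)) =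
      (Measure.pi μ).withDensity fun x => ∏ i, f i (x i) := by
  refine Measure.pi_eq fun s hs => ?_
  rw [withDensity_apply _ (MeasurableSet.univ_pi hs), Measure.restrict_pi_pi,
    lintegral_pi_prod _ hf]
  exact Finset.prod_congr rfl fun i _ => (withDensity_apply _ (hs i)).symm

theorem det_eq_sum_sign_mul_prod {n : ℕ} (M : Matrix (Fin n) (Fin n) ℝ) :
    M.det = ∑ σ : Equiv.Perm (Fin n), ((Equiv.Perm.sign σ : ℤ) : ℝ) * ∏ i, M i (σ i) := by
  rw [← Matrix.det_transpose, Matrix.det_apply']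
  simp

/-- Integrating a determinant whose `i`-th row depends on the `i`-th variable only. -/
theorem integral_pi_det {n : ℕ} (μ : Fin n → Measure ℝ) [∀ i, SigmaFinite (μ i)]
    {f : Fin n → ℝ → ℝ} (hf : ∀ i j, Integrable (f j) (μ i)) :
    Integrable (fun x : Fin n → ℝ => (Matrix.of fun i j => f j (x i)).det) (Measure.pi μ) ∧
    ∫ x, (Matrix.of fun i j => f j (x i)).det ∂Measure.pi μ =
      (Matrix.of fun i j => ∫ y, f j y ∂μ i).det := by
  simp only [det_eq_sum_sign_mul_prod, Matrix.of_apply]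
  have hi : ∀ σ : Equiv.Perm (Fin n), Integrable (fun x : Fin n → ℝ =>
      ((Equiv.Perm.sign σ : ℤ) : ℝ) * ∏ i, f (σ i) (x i)) (Measure.pi μ) := fun σ =>
    (Integrable.fintype_prod fun i => hf i (σ i)).const_mul _
  refine ⟨integrable_finsetSum _ fun σ _ => hi σ, ?_⟩
  rw [integral_finsetSum _ fun σ _ => hi σ]
  refine Finset.sum_congr rfl fun σ _ => ?_
  rw [integral_const_mul, integral_fintype_prod_eq_prod (fun i => f (σ i))]

end ProductMeasures

/-! ### The integral of the Vandermonde determinant over a box -/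

section VandermondeBox

/-- Subtracting consecutive rows of the Vandermonde matrix. -/
theorem det_pow_sub_pow {k : ℕ} (μ : Fin (k + 1) → ℝ) :
    (Matrix.of fun i j : Fin k => μ i.succ ^ ((j : ℕ) + 1) - μ i.castSucc ^ ((j : ℕ) + 1)).det =
      (Matrix.vandermonde μ).det := by
  set B : Matrix (Fin (k + 1)) (Fin (k + 1)) ℝ := Matrix.of fun i j =>
    (Fin.cases (μ 0 ^ (j : ℕ)) (fun i => μ i.succ ^ (j : ℕ) - μ i.castSucc ^ (j : ℕ)) i : ℝ) with hB
  have h1 : (Matrix.vandermonde μ).det = B.det := by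
    refine Matrix.det_eq_of_forall_row_eq_smul_add_pred (fun _ => 1) (fun j => ?_) fun i j => ?_
    · simp [hB, Matrix.vandermonde_apply]
    · simp [hB, Matrix.vandermonde_apply]
  rw [h1, Matrix.det_succ_column_zero, Fin.sum_univ_succ, Finset.sum_eq_zero]
  · simp only [hB, Matrix.of_apply, Fin.cases_zero, Fin.val_zero, pow_zero, one_mul, add_zero]
    congr 1
  · intro i _
    simp [hB]

/-- The integral of the Vandermonde determinant over the vectors interlacing `μ` strictly. -/
theorem lintegral_box_det_vandermonde {k : ℕ} {μ : Fin (k + 1) → ℝ} (hμ : StrictMono μ) :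
    ∫⁻ x in Set.univ.pi fun i : Fin k => Set.Ioo (μ i.castSucc) (μ i.succ),
        ENNReal.ofReal (Matrix.vandermonde x).det =
      ENNReal.ofReal ((Matrix.vandermonde μ).det / (k ! : ℝ)) := by
  set ρ : Fin k → Measure ℝ := fun i => volume.restrict (Set.Ioo (μ i.castSucc) (μ i.succ)) with hρ
  have hint : ∀ i j : Fin k, Integrable (fun y : ℝ => y ^ (j : ℕ)) (ρ i) := fun i j =>
    ((continuous_pow (j : ℕ)).integrableOn_Icc).mono_set Set.Ioo_subset_Icc_self
  obtain ⟨h1, h2⟩ := integral_pi_det ρ hint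
  have hval : ∀ i j : Fin k, ∫ y, y ^ (j : ℕ) ∂ρ i =
      ((j : ℝ) + 1)⁻¹ * (μ i.succ ^ ((j : ℕ) + 1) - μ i.castSucc ^ ((j : ℕ) + 1)) := by
    intro i j
    rw [hρ, ← integral_Ioc_eq_integral_Ioo,
      ← intervalIntegral.integral_of_le (hμ Fin.castSucc_lt_succ).le, integral_pow]
    ring
  have hv : ∀ x : Fin k → ℝ, (Matrix.of fun i j : Fin k => x i ^ (j : ℕ)) = Matrix.vandermonde x :=
    fun _ => rfl
  have hfac : ∏ j : Fin k, ((j : ℝ) + 1) = (k ! : ℝ) := by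
    rw [Fin.prod_univ_eq_prod_range (fun j => (j : ℝ) + 1) k, ← Finset.prod_range_add_one_eq_factorial]
    push_cast
    rfl
  simp only [hval, hv] at h1 h2
  have h3 := Matrix.det_mul_row (fun j : Fin k => ((j : ℝ) + 1)⁻¹)
    (Matrix.of fun i j : Fin k => μ i.succ ^ ((j : ℕ) + 1) - μ i.castSucc ^ ((j : ℕ) + 1))
  simp only [Matrix.of_apply] at h3
  rw [h3, det_pow_sub_pow, Finset.prod_inv_distrib, hfac] at h2
  rw [volume_pi, Measure.restrict_pi_pi, div_eq_inv_mul, ← h2,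
    ofReal_integral_eq_lintegral_ofReal h1]
  rw [← Measure.restrict_pi_pi]
  refine (ae_restrict_iff' (MeasurableSet.univ_pi fun _ => measurableSet_Ioo)).2
    (Filter.Eventually.of_forall fun x hx => (det_vandermonde_pos ?_).le)
  intro i j hij
  have hi := (hx i (Set.mem_univ i)).2
  have hj := (hx j (Set.mem_univ j)).1
  exact (hi.trans_le (hμ.monotone (Fin.le_def.2 (Nat.succ_le_of_lt hij)))).trans hj

end VandermondeBox

/-! ### Gamma distributions of integer shape -/

section Gamma

/-- The density `t ^ s e^{-t} / s!` on `(0, ∞)` of the Gamma distribution with integer shape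
`s + 1` and rate `1`. -/
noncomputable def gammaDensity (s : ℕ) (t : ℝ) : ENNReal :=
  (Set.Ioi 0).indicator (fun t => ENNReal.ofReal (t ^ s * Real.exp (-t) / (s ! : ℝ))) t

@[fun_prop]
theorem measurable_gammaDensity (s : ℕ) : Measurable (gammaDensity s) :=
  Measurable.indicator (by fun_prop) measurableSet_Ioi

/-- The Gamma distribution with integer shape `s + 1` and rate `1`; `s = 0` is the exponential
distribution. -/
noncomputable def gammaLaw (s : ℕ) : Measure ℝ := volume.withDensity (gammaDensity s)

theorem gammaDensity_of_pos {s : ℕ} {t : ℝ} (ht : 0 < t) :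
    gammaDensity s t = ENNReal.ofReal (t ^ s * Real.exp (-t) / (s ! : ℝ)) :=
  Set.indicator_of_mem (Set.mem_Ioi.2 ht) _

theorem gammaDensity_of_nonpos {s : ℕ} {t : ℝ} (ht : t ≤ 0) : gammaDensity s t = 0 :=
  Set.indicator_of_notMem (by simpa using ht) _

instance isProbabilityMeasure_gammaLaw (s : ℕ) : IsProbabilityMeasure (gammaLaw s) := by
  constructor
  rw [gammaLaw, withDensity_apply _ MeasurableSet.univ, Measure.restrict_univ]
  simp only [gammaDensity]
  have hG := Real.GammaIntegral_convergent (s := (s : ℝ) + 1) (by positivity)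
  rw [lintegral_indicator measurableSet_Ioi, ← ofReal_integral_eq_lintegral_ofReal]
  · have h1 : ∫ t in Set.Ioi (0 : ℝ), t ^ s * Real.exp (-t) = (s ! : ℝ) := by
      rw [← Real.Gamma_nat_eq_factorial, Real.Gamma_eq_integral (by positivity)]
      refine setIntegral_congr_fun measurableSet_Ioi fun t _ => ?_
      simp [mul_comm]
    rw [integral_div, h1, div_self (by positivity), ENNReal.ofReal_one]
  · refine Integrable.div_const (hG.congr_fun (fun t _ => ?_) measurableSet_Ioi) _
    simp [mul_comm]
  · refine (ae_restrict_iff' measurableSet_Ioi).2 (Filter.Eventually.of_forall fun t ht => ?_)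
    have : (0 : ℝ) < t := ht
    show 0 ≤ _
    positivity

theorem lintegral_gammaDensity_convolution (s : ℕ) (u : ℝ) :
    ∫⁻ x, gammaDensity s x * gammaDensity 0 (u - x) = gammaDensity (s + 1) u := by
  have h1 : ∀ x, gammaDensity s x * gammaDensity 0 (u - x) =
      (Set.Ioo 0 u).indicator
        (fun x => ENNReal.ofReal (x ^ s * (Real.exp (-u) / (s ! : ℝ)))) x := by
    intro x
    by_cases hx : x ∈ Set.Ioo 0 u
    · have h0 : 0 < x := hx.1
      rw [Set.indicator_of_mem hx, gammaDensity_of_pos hx.1, gammaDensity_of_pos (sub_pos.2 hx.2),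
        ← ENNReal.ofReal_mul (by positivity)]
      congr 1
      have : Real.exp (-u) = Real.exp (-x) * Real.exp (-(u - x)) := by
        rw [← Real.exp_add]
        congr 1
        ring
      rw [this]
      simp
      ring
    · rw [Set.indicator_of_notMem hx]
      rcases le_or_gt x 0 with h | h
      · rw [gammaDensity_of_nonpos h, zero_mul]
      · rw [gammaDensity_of_nonpos (t := u - x), mul_zero]
        by_contra h'
        exact hx ⟨h, by linarith⟩
  simp only [h1]
  rw [lintegral_indicator measurableSet_Ioo]
  rcases le_or_gt u 0 with hu | hu
  · rw [gammaDensity_of_nonpos hu, Set.Ioo_eq_empty hu.not_gt]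
    simp
  rw [gammaDensity_of_pos hu, ← ofReal_integral_eq_lintegral_ofReal]
  · congr 1
    rw [integral_mul_const, ← integral_Ioc_eq_integral_Ioo,
      ← intervalIntegral.integral_of_le hu.le, integral_pow, Nat.factorial_succ]
    push_cast
    field_simp
    simp
  · exact (Continuous.integrableOn_Icc (by fun_prop)).mono_set Set.Ioo_subset_Icc_self
  · refine (ae_restrict_iff' measurableSet_Ioo).2 (Filter.Eventually.of_forall fun t ht => ?_)
    have : (0 : ℝ) < t := ht.1
    show 0 ≤ _
    positivity

theorem map_add_gammaLaw_prod (s : ℕ) :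
    ((gammaLaw 0).prod (gammaLaw s)).map (fun p : ℝ × ℝ => p.1 + p.2) = gammaLaw (s + 1) := by
  refine Measure.ext_of_lintegral _ fun F hF => ?_
  rw [lintegral_map hF (by fun_prop), lintegral_prod_symm' _ (by fun_prop)]
  have h1 : ∀ y, ∫⁻ x, F (x + y) ∂gammaLaw 0 = ∫⁻ u, gammaDensity 0 (u - y) * F u := by
    intro y
    rw [gammaLaw, lintegral_withDensity_eq_lintegral_mul _ (by fun_prop) (by fun_prop),
      ← lintegral_add_right_eq_self (fun u => gammaDensity 0 (u - y) * F u) y]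
    simp
  simp only [h1]
  rw [gammaLaw, lintegral_withDensity_eq_lintegral_mul _ (by fun_prop) (by fun_prop),
    gammaLaw, lintegral_withDensity_eq_lintegral_mul _ (by fun_prop) (by fun_prop)]
  have h2 : ∀ y, (gammaDensity s * fun y => ∫⁻ u, gammaDensity 0 (u - y) * F u) y =
      ∫⁻ u, gammaDensity s y * (gammaDensity 0 (u - y) * F u) := fun y =>
    (lintegral_const_mul _ (by fun_prop)).symm
  simp only [h2, Pi.mul_apply]
  rw [lintegral_lintegral_swap (by fun_prop)]
  refine lintegral_congr fun u => ?_
  rw [← lintegral_gammaDensity_convolution, ← lintegral_mul_const _ (by fun_prop)]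
  simp only [mul_assoc]

/-- A sum of `s + 1` independent exponential variables has the Gamma distribution. -/
theorem map_sum_pi_gammaLaw (s : ℕ) :
    (Measure.pi fun _ : Fin (s + 1) => gammaLaw 0).map (fun x => ∑ i, x i) = gammaLaw s := by
  induction s with
  | zero =>
    have := (measurePreserving_funUnique (gammaLaw 0) (Fin 1)).map_eq
    simpa using! this
  | succ s ih =>
    rw [← (measurePreserving_finCons fun _ : Fin (s + 1 + 1) => gammaLaw 0).map_eq,
      Measure.map_map (by fun_prop)
        (measurePreserving_finCons fun _ : Fin (s + 1 + 1) => gammaLaw 0).measurable,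
      ← map_add_gammaLaw_prod, ← ih]
    rw [← Measure.map_id (μ := gammaLaw 0), Measure.map_prod_map _ _ measurable_id (by fun_prop),
      Measure.map_map (by fun_prop) (by fun_prop), Measure.map_id]
    congr 1
    funext p
    simp [Fin.sum_univ_succ]

end Gamma

/-! ### Standard complex normal vectors -/

section ComplexNormal

theorem measurable_complexNormal_density :
    Measurable fun z : ℂ => ENNReal.ofReal (Real.pi⁻¹ * Real.exp (-‖z‖ ^ 2)) := by fun_prop

/-- The squared modulus of a standard complex normal variable is exponential. -/
theorem map_normSq_complexNormal : complexNormal.map (fun z => ‖z‖ ^ 2) = gammaLaw 0 := by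
  refine Measure.ext_of_lintegral _ fun F hF => ?_
  rw [lintegral_map hF (by fun_prop), complexNormal,
    lintegral_withDensity_eq_lintegral_mul _ measurable_complexNormal_density (by fun_prop),
    ← Complex.lintegral_comp_polarCoord_symm]
  simp only [Pi.mul_apply, Complex.norm_polarCoord_symm, sq_abs, smul_eq_mul]
  rw [polarCoord_target, Measure.volume_eq_prod, ← Measure.prod_restrict,
    lintegral_prod _ (by fun_prop)]
  simp only [lintegral_const, Measure.restrict_apply_univ, Real.volume_Ioo]
  have himg : (fun r : ℝ => r ^ 2) '' Set.Ioi 0 = Set.Ioi 0 := by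
    ext t
    constructor
    · rintro ⟨r, hr, rfl⟩
      exact pow_pos (Set.mem_Ioi.1 hr) 2
    · exact fun ht => ⟨√t, Real.sqrt_pos.2 ht, Real.sq_sqrt (le_of_lt ht)⟩
  rw [gammaLaw, lintegral_withDensity_eq_lintegral_mul _ (by fun_prop) hF]
  have h1 : ∀ t, (gammaDensity 0 * F) t =
      (Set.Ioi 0).indicator (fun t => ENNReal.ofReal (Real.exp (-t)) * F t) t := by
    intro t
    by_cases ht : 0 < t
    · rw [Set.indicator_of_mem (Set.mem_Ioi.2 ht), Pi.mul_apply, gammaDensity_of_pos ht]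
      simp
    · rw [Set.indicator_of_notMem (by simpa using ht), Pi.mul_apply,
        gammaDensity_of_nonpos (not_lt.1 ht), zero_mul]
  simp only [h1]
  rw [lintegral_indicator measurableSet_Ioi]
  conv_rhs => rw [← himg]
  rw [lintegral_image_eq_lintegral_abs_deriv_mul (f' := fun r => 2 * r) measurableSet_Ioi
    (fun r _ => by simpa using (hasDerivAt_pow 2 r).hasDerivWithinAt)
    (fun x hx y hy h => (pow_left_inj₀ (le_of_lt hx) (le_of_lt hy) two_ne_zero).1 h)]
  refine setLIntegral_congr_fun measurableSet_Ioi fun r hr => ?_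
  have hr0 : 0 < r := hr
  have hπ := Real.pi_pos
  rw [abs_of_pos (by positivity : 0 < 2 * r)]
  simp only [← mul_assoc]
  rw [← ENNReal.ofReal_mul hr0.le, mul_right_comm, ← ENNReal.ofReal_mul (by positivity),
    ← ENNReal.ofReal_mul (by positivity)]
  congr 2
  field_simp
  ring

instance isProbabilityMeasure_complexNormal : IsProbabilityMeasure complexNormal := by
  constructor
  have h := congrArg (fun μ : Measure ℝ => μ Set.univ) map_normSq_complexNormal
  simp only [Measure.map_apply (show Measurable fun z : ℂ => ‖z‖ ^ 2 by fun_prop)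
    MeasurableSet.univ, Set.preimage_univ, measure_univ] at h
  exact h

theorem pi_complexNormal (n : ℕ) :
    (Measure.pi fun _ : Fin n => complexNormal) =
      volume.withDensity fun v : Fin n → ℂ =>
        ENNReal.ofReal ((Real.pi⁻¹) ^ n * Real.exp (-∑ i, ‖v i‖ ^ 2)) := by
  have : ∀ _ : Fin n, SigmaFinite ((volume : Measure ℂ).withDensity
      fun z : ℂ => ENNReal.ofReal (Real.pi⁻¹ * Real.exp (-‖z‖ ^ 2))) := fun _ =>
    inferInstanceAs (SigmaFinite complexNormal)
  have h := pi_withDensity (fun _ : Fin n => (volume : Measure ℂ))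
    (fun _ => measurable_complexNormal_density)
  unfold complexNormal
  rw [h, volume_pi]
  congr 1
  funext v
  rw [← ENNReal.ofReal_prod_of_nonneg (fun _ _ => by positivity), Finset.prod_mul_distrib,
    ← Real.exp_sum]
  simp

theorem measurePreserving_mulVec_volume {n : ℕ} {U : Matrix (Fin n) (Fin n) ℂ}
    (hU : U ∈ Matrix.unitaryGroup (Fin n) ℂ) :
    MeasurePreserving (fun v : Fin n → ℂ => U *ᵥ v) volume volume := by
  have hdet : LinearMap.det ((Matrix.toLin' U).restrictScalars ℝ) = 1 := by
    rw [LinearMap.det_restrictScalars, LinearMap.det_toLin', Algebra.norm_complex_apply,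
      Complex.normSq_eq_norm_sq]
    have := Matrix.det_of_mem_unitary hU
    rw [CStarRing.norm_of_mem_unitary this, one_pow]
  refine ⟨(Matrix.toLin' U).continuous_of_finiteDimensional.measurable, ?_⟩
  have h := Measure.map_linearMap_addHaar_eq_smul_addHaar (volume : Measure (Fin n → ℂ))
    (f := (Matrix.toLin' U).restrictScalars ℝ) (by rw [hdet]; exact one_ne_zero)
  rw [hdet] at h
  simpa using! h

theorem sum_normSq_mulVec {n : ℕ} {U : Matrix (Fin n) (Fin n) ℂ}
    (hU : U ∈ Matrix.unitaryGroup (Fin n) ℂ) (v : Fin n → ℂ) :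
    ∑ i, ‖(U *ᵥ v) i‖ ^ 2 = ∑ i, ‖v i‖ ^ 2 := by
  have h1 : ∀ w : Fin n → ℂ, ((∑ i, ‖w i‖ ^ 2 : ℝ) : ℂ) = star w ⬝ᵥ w := by
    intro w
    rw [dotProduct]
    push_cast
    refine Finset.sum_congr rfl fun i _ => ?_
    rw [← Complex.conj_mul']
    rfl
  have h2 : star (U *ᵥ v) ⬝ᵥ (U *ᵥ v) = star v ⬝ᵥ v := by
    rw [Matrix.star_mulVec, Matrix.dotProduct_mulVec, Matrix.vecMul_vecMul,
      ← Matrix.star_eq_conjTranspose, Matrix.mem_unitaryGroup_iff'.1 hU, Matrix.vecMul_one]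
  exact_mod_cast (h1 _).trans (h2.trans (h1 v).symm)

/-- A vector of independent standard complex normal variables is unitarily invariant. -/
theorem map_mulVec_pi_complexNormal {n : ℕ} {U : Matrix (Fin n) (Fin n) ℂ}
    (hU : U ∈ Matrix.unitaryGroup (Fin n) ℂ) :
    (Measure.pi fun _ : Fin n => complexNormal).map (fun v => U *ᵥ v) =
      Measure.pi fun _ : Fin n => complexNormal := by
  have hm := measurePreserving_mulVec_volume hU
  refine Measure.ext_of_lintegral _ fun F hF => ?_
  rw [lintegral_map hF hm.measurable, pi_complexNormal,
    lintegral_withDensity_eq_lintegral_mul (g := fun v => F (U *ᵥ v)) _ (by fun_prop)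
      (hF.comp hm.measurable),
    lintegral_withDensity_eq_lintegral_mul _ (by fun_prop) hF,
    ← hm.lintegral_comp (Measurable.mul (by fun_prop) hF)]
  simp only [Pi.mul_apply, sum_normSq_mulVec hU]

end ComplexNormal

/-! ### Eigenvalues in increasing order -/

section AscendingEigenvalues

/-- The eigenvalues of `A A†` in increasing order, with multiplicity. -/
noncomputable def ascEig {k n : ℕ} (A : Fin k → Fin n → ℂ) : Fin k → ℝ := fun i =>
  (Matrix.isHermitian_mul_conjTranspose_self (Matrix.of A)).eigenvalues₀
    (Fin.cast (Fintype.card_fin k).symm (Fin.rev i))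

/-- The permutation, independent of the matrix, relating Mathlib's enumeration of the eigenvalues to
the increasing one. -/
noncomputable def ascIndex (k : ℕ) : Equiv.Perm (Fin k) :=
  (Fintype.equivOfCardEq (Fintype.card_fin _)).symm.trans
    ((finCongr (Fintype.card_fin k)).trans Fin.revPerm)

theorem wishartEigenvalues_eq_ascEig {k n : ℕ} (A : Fin k → Fin n → ℂ) (i : Fin k) :
    wishartEigenvalues (Matrix.of A) i = ascEig A (ascIndex k i) := by
  simp [wishartEigenvalues, Matrix.IsHermitian.eigenvalues, ascEig, ascIndex]

theorem monotone_ascEig {k n : ℕ} (A : Fin k → Fin n → ℂ) : Monotone (ascEig A) :=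
  fun _ _ hij => Matrix.IsHermitian.eigenvalues₀_antitone _ (Fin.rev_le_rev.2 hij)

open Polynomial in
theorem charpoly_eq_prod_ascEig {k n : ℕ} (A : Fin k → Fin n → ℂ) :
    (Matrix.of A * (Matrix.of A)ᴴ).charpoly = ∏ i, (X - C (ascEig A i : ℂ)) := by
  rw [(Matrix.isHermitian_mul_conjTranspose_self (Matrix.of A)).charpoly_eq,
    ← Equiv.prod_comp (ascIndex k) fun i => X - C (ascEig A i : ℂ)]
  exact Finset.prod_congr rfl fun i _ => by
    rw [← wishartEigenvalues_eq_ascEig]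
    rfl

theorem prod_sub_ascEig {k n : ℕ} (A : Fin k → Fin n → ℂ) (z : ℂ) :
    ∏ i, (z - (ascEig A i : ℂ)) =
      (Matrix.scalar (Fin k) z - Matrix.of A * (Matrix.of A)ᴴ).det := by
  rw [← Matrix.eval_charpoly, charpoly_eq_prod_ascEig, Polynomial.eval_prod]
  simp

/-- An increasing vector is a continuous injective image of its monic polynomial, so it depends
measurably on it (Lusin–Souslin). -/
theorem measurable_ascEig {k n : ℕ} : Measurable (ascEig : (Fin k → Fin n → ℂ) → Fin k → ℝ) := by
  set S : Set (Fin k → ℝ) := {a | Monotone a} with hS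
  -- the values of the polynomial at the natural numbers determine it
  set f : (Fin k → ℝ) → ℕ → ℂ := fun a z => ∏ i, ((z : ℂ) - (a i : ℂ)) with hf
  have hSm : MeasurableSet S := isClosed_monotone.measurableSet
  have hfc : Continuous f := by fun_prop
  have hinj : Set.InjOn f S := by
    intro a ha b hb hab
    refine eq_of_monotone_of_prod_X_sub_C_eq ha hb ?_
    refine Polynomial.eq_of_infinite_eval_eq _ _ ?_
    refine (Set.infinite_range_of_injective (Nat.cast_injective (R := ℝ))).mono ?_
    rintro _ ⟨z, rfl⟩
    have := congrFun hab z
    simp only [hf] at this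
    simp only [Set.mem_ofPred_eq, Polynomial.eval_prod, Polynomial.eval_sub, Polynomial.eval_X,
      Polynomial.eval_C]
    exact_mod_cast this
  have hemb := hfc.continuousOn.measurableEmbedding hSm hinj
  have hg : Measurable fun A : Fin k → Fin n → ℂ => (⟨ascEig A, monotone_ascEig A⟩ : S) := by
    rw [← hemb.measurable_comp_iff]
    refine measurable_pi_lambda _ fun z => ?_
    have : (fun A : Fin k → Fin n → ℂ =>
        ((S.domRestrict f) ∘ fun A => (⟨ascEig A, monotone_ascEig A⟩ : S)) A z) =
        fun A => (Matrix.scalar (Fin k) (z : ℂ) - Matrix.of A * (Matrix.of A)ᴴ).det := by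
      funext A
      exact prod_sub_ascEig A z
    rw [this]
    refine Continuous.measurable ?_
    have hc : Continuous fun A : Fin k → Fin n → ℂ => (Matrix.of A : Matrix (Fin k) (Fin n) ℂ) :=
      continuous_id
    exact (continuous_const.sub (hc.matrix_mul hc.matrix_conjTranspose)).matrix_det
  exact measurable_subtype_coe.comp hg

end AscendingEigenvalues

/-! ### The secular equation of an additional row -/

section RankOneUpdate

theorem exists_equiv_of_prod_X_sub_C_eq {R : Type*} [CommRing R] [IsDomain R]
    {ι κ : Type*} [Fintype ι] [Fintype κ] {f : ι → R} {g : κ → R}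
    (h : ∏ i, (Polynomial.X - Polynomial.C (f i)) = ∏ i, (Polynomial.X - Polynomial.C (g i))) :
    ∃ e : κ ≃ ι, ∀ i, f (e i) = g i := by
  classical
  have hm := map_univ_val_eq_of_prod_X_sub_C_eq h
  have hc : ∀ y, Fintype.card {i // g i = y} = Fintype.card {i // f i = y} := by
    intro y
    have := congrArg (Multiset.count y) hm
    rw [Multiset.count_map, Multiset.count_map] at this
    rw [Fintype.card_subtype, Fintype.card_subtype, Finset.card_def, Finset.card_def,
      Finset.filter_val, Finset.filter_val]
    simp only [eq_comm (b := y)]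
    simp only [eq_comm (a := y)] at this ⊢
    exact this.symm
  let e : κ ≃ ι := (Equiv.sigmaFiberEquiv g).symm.trans
    ((Equiv.sigmaCongrRight fun y => Fintype.equivOfCardEq (hc y)).trans (Equiv.sigmaFiberEquiv f))
  refine ⟨e, fun i => ?_⟩
  exact (Fintype.equivOfCardEq (hc (g i)) ⟨i, rfl⟩).2

theorem det_diagonal_sub_mul_star {n : ℕ} {b w : Fin n → ℂ} (hb : ∀ i, b i ≠ 0) :
    (Matrix.diagonal b - Matrix.of fun i j => w i * star (w j)).det =
      (∏ i, b i) * (1 - ∑ i, ((‖w i‖ ^ 2 : ℝ) : ℂ) / b i) := by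
  have h : Matrix.diagonal b - Matrix.of (fun i j => w i * star (w j)) =
      Matrix.diagonal b * (1 + Matrix.replicateCol Unit (fun i => -(w i / b i)) *
        Matrix.replicateRow Unit (fun j => star (w j))) := by
    ext i j
    rw [Matrix.mul_add, Matrix.mul_one, Matrix.add_apply, Matrix.sub_apply, Matrix.diagonal_mul]
    simp only [Matrix.of_apply, Matrix.mul_apply, Matrix.replicateCol_apply,
      Matrix.replicateRow_apply, Finset.univ_unique, Finset.sum_singleton]
    field_simp [hb i]
    ring
  rw [h, Matrix.det_mul, Matrix.det_diagonal, Matrix.det_one_add_replicateCol_mul_replicateRow,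
    dotProduct]
  congr 1
  rw [sub_eq_add_neg, ← Finset.sum_neg_distrib]
  congr 1
  refine Finset.sum_congr rfl fun i _ => ?_
  have : star (w i) * w i = ((‖w i‖ ^ 2 : ℝ) : ℂ) := by
    rw [Complex.ofReal_pow]
    exact Complex.conj_mul' (w i)
  rw [← this]
  ring

/-- The weights of the secular equation of a rank-one update: the total squared modulus of the
components of `w` along the kernel, followed by the squared moduli of the other components. -/
noncomputable def blockWeight {n r k : ℕ} (e : Fin r ⊕ Fin k ≃ Fin n) (w : Fin n → ℂ) :
    Fin (k + 1) → ℝ :=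
  Fin.cons (∑ i, ‖w (e (Sum.inl i))‖ ^ 2) fun j => ‖w (e (Sum.inr j))‖ ^ 2

open Polynomial in
/-- Adding a row `v` to `A` adds a rank-one term to `A† A`. In an eigenbasis of `A† A` the new
characteristic polynomial is the secular polynomial of the squared moduli of the components. -/
theorem exists_unitary_prod_X_sub_C_ascEig_cons {k n r : ℕ} (hr : n = (r + 1) + k)
    (A : Fin k → Fin n → ℂ) :
    ∃ U ∈ Matrix.unitaryGroup (Fin n) ℂ, ∃ e : Fin (r + 1) ⊕ Fin k ≃ Fin n, ∀ v : Fin n → ℂ,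
      ∏ i, (X - C (ascEig (Fin.cons v A : Fin (k + 1) → Fin n → ℂ) i)) =
        ∏ i, (X - C ((Fin.cons 0 (ascEig A) : Fin (k + 1) → ℝ) i)) -
          ∑ i, C (blockWeight e (U *ᵥ v) i) *
            ∏ j ∈ Finset.univ.erase i, (X - C ((Fin.cons 0 (ascEig A) : Fin (k + 1) → ℝ) j)) := by
  set M : Matrix (Fin k) (Fin n) ℂ := Matrix.of A with hM
  have hH : (Mᴴ * M).IsHermitian := Matrix.isHermitian_conjTranspose_mul_self M
  set d := hH.eigenvalues with hd
  set W : Matrix (Fin n) (Fin n) ℂ := (hH.eigenvectorUnitary : Matrix (Fin n) (Fin n) ℂ) with hW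
  have hWm : W ∈ Matrix.unitaryGroup (Fin n) ℂ := hH.eigenvectorUnitary.2
  have hWW : W * Wᴴ = 1 := Matrix.mem_unitaryGroup_iff.1 hWm
  have hspec : Mᴴ * M = W * Matrix.diagonal (fun i => (d i : ℂ)) * Wᴴ := by
    conv_lhs => rw [hH.spectral_theorem, Unitary.conjStarAlgAut_apply]
    rfl
  -- the spectrum of `A† A` is that of `A A†`, with additional zeros
  obtain ⟨e, he⟩ : ∃ e : Fin (r + 1) ⊕ Fin k ≃ Fin n,
      ∀ s, d (e s) = Sum.elim (fun _ => 0) (ascEig A) s := by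
    refine exists_equiv_of_prod_X_sub_C_eq (Polynomial.map_injective (algebraMap ℝ ℂ)
      (algebraMap ℝ ℂ).injective ?_)
    have h1 := Matrix.charpoly_mul_comm_of_le Mᴴ M (by simp; omega)
    rw [hH.charpoly_eq, charpoly_eq_prod_ascEig] at h1
    simp only [Polynomial.map_prod, Polynomial.map_sub, Polynomial.map_X, Polynomial.map_C,
      Polynomial.map_mul, Polynomial.map_pow, Complex.coe_algebraMap,
      Fintype.prod_sum_type, Sum.elim_inl, Sum.elim_inr, map_zero, sub_zero, Finset.prod_const,
      Finset.card_univ, Fintype.card_fin]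
    simp only [Fintype.card_fin] at h1
    rw [show n - k = r + 1 by omega] at h1
    exact h1
  have hWt : Wᵀ ∈ Matrix.unitaryGroup (Fin n) ℂ := by
    rw [Matrix.mem_unitaryGroup_iff', Matrix.star_eq_conjTranspose, ← Matrix.transpose_one, ← hWW,
      Matrix.transpose_mul]
    rfl
  refine ⟨Wᵀ, hWt, e, fun v => ?_⟩
  set t := blockWeight e (Wᵀ *ᵥ v) with ht
  set a : Fin (k + 1) → ℝ := Fin.cons 0 (ascEig A) with ha
  set M' : Matrix (Fin (k + 1)) (Fin n) ℂ := Matrix.of (Fin.cons v A : Fin (k + 1) → Fin n → ℂ)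
    with hM'
  -- `w` has the coordinates of `v†` in the eigenbasis; its entries are conjugate to those of `Wᵀ v`
  set w : Fin n → ℂ := Wᴴ *ᵥ star v with hw
  have hwn : ∀ i, ‖w i‖ = ‖(Wᵀ *ᵥ v) i‖ := by
    intro i
    have : w = star (Wᵀ *ᵥ v) := by
      rw [Matrix.star_mulVec, hw, ← Matrix.vecMul_transpose]
      rfl
    rw [this, Pi.star_apply, norm_star]
  have hWw : W *ᵥ w = star v := by
    rw [hw, Matrix.mulVec_mulVec, hWW, Matrix.one_mulVec]
  have hgram : M'ᴴ * M' = Mᴴ * M + Matrix.of fun i j => star (v i) * v j := by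
    ext i j
    rw [Matrix.add_apply, Matrix.mul_apply, Matrix.mul_apply, Fin.sum_univ_succ, add_comm]
    rfl
  have hconj : W * (Matrix.of fun i j => w i * star (w j)) * Wᴴ =
      Matrix.of fun i j => star (v i) * v j := by
    ext i j
    have h1 : star (v i) = ∑ l, W i l * w l := (congrFun hWw i).symm
    have h2 : v j = ∑ l, star (w l) * star (W j l) := by
      have := congrArg star (congrFun hWw j)
      rw [Pi.star_apply, star_star] at this
      rw [← this, Matrix.mulVec, dotProduct, star_sum]
      exact Finset.sum_congr rfl fun l _ => star_mul _ _
    rw [Matrix.of_apply, h1, h2, Matrix.mul_apply, Finset.mul_sum]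
    refine Finset.sum_congr rfl fun l _ => ?_
    rw [Matrix.mul_apply, Finset.sum_mul, Finset.sum_mul]
    refine Finset.sum_congr rfl fun l' _ => ?_
    rw [Matrix.of_apply, Matrix.conjTranspose_apply]
    ring
  -- it suffices to compare values away from finitely many points
  refine Polynomial.eq_of_infinite_eval_eq _ _ ?_
  refine ((Set.finite_range d).insert 0).infinite_compl.mono fun z hz => ?_
  simp only [Set.mem_compl_iff, Set.mem_insert_iff, Set.mem_range, not_or, not_exists] at hz
  obtain ⟨hz0, hzd⟩ := hz
  have hz0' : (z : ℂ) ≠ 0 := by exact_mod_cast hz0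
  have hb : ∀ i, (z : ℂ) - d i ≠ 0 := fun i => by
    rw [← Complex.ofReal_sub]
    exact_mod_cast sub_ne_zero.2 fun h => hzd i h.symm
  have hza : ∀ i, z - a i ≠ 0 := by
    refine Fin.cases ?_ fun j => ?_
    · simpa [ha] using hz0
    · have := he (Sum.inr j)
      simp only [Sum.elim_inr] at this
      simp only [ha, Fin.cons_succ, ← this]
      exact sub_ne_zero.2 fun h => hzd _ h.symm
  have hdet : (Matrix.scalar (Fin n) (z : ℂ) - M'ᴴ * M').det =
      (∏ i, ((z : ℂ) - d i)) * (1 - ∑ i, ((‖w i‖ ^ 2 : ℝ) : ℂ) / ((z : ℂ) - d i)) := by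
    have h1 : Matrix.scalar (Fin n) (z : ℂ) - M'ᴴ * M' =
        W * (Matrix.diagonal (fun i => (z : ℂ) - d i) - Matrix.of fun i j => w i * star (w j)) *
          Wᴴ := by
      rw [hgram, hspec, ← hconj, ← Matrix.diagonal_sub, Matrix.mul_sub, Matrix.sub_mul,
        Matrix.mul_sub, Matrix.sub_mul]
      have : W * Matrix.diagonal (fun _ => (z : ℂ)) * Wᴴ = Matrix.scalar (Fin n) (z : ℂ) := by
        rw [← Matrix.scalar_apply, ← (Matrix.scalar_commute (z : ℂ) (fun _ => mul_comm _ _) W).eq,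
          Matrix.mul_assoc, hWW, Matrix.mul_one]
      rw [this]
      abel
    rw [h1, Matrix.det_mul_right_comm, hWW, Matrix.one_mul, det_diagonal_sub_mul_star hb]
  have hcomm := congrArg (Polynomial.eval (z : ℂ)) (Matrix.charpoly_mul_comm' M' M'ᴴ)
  rw [charpoly_eq_prod_ascEig] at hcomm
  simp only [eval_mul, eval_pow, eval_X, Matrix.eval_charpoly, Fintype.card_fin] at hcomm
  rw [hdet] at hcomm
  -- all quantities are real, so the identity descends from `ℂ` to `ℝ`
  have hreal : z ^ n * ∏ i, (z - ascEig (Fin.cons v A : Fin (k + 1) → Fin n → ℂ) i) =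
      z ^ (k + 1) * ((∏ i, (z - d i)) * (1 - ∑ i, ‖w i‖ ^ 2 / (z - d i))) := by
    rw [eval_prod] at hcomm
    simp only [eval_sub, eval_X, eval_C] at hcomm
    exact_mod_cast hcomm
  have hprod : ∏ i, (z - d i) = z ^ (r + 1) * ∏ j, (z - ascEig A j) := by
    rw [← Equiv.prod_comp e, Fintype.prod_sum_type]
    simp [he]
  have hsum : ∑ i, ‖w i‖ ^ 2 / (z - d i) = ∑ i, t i / (z - a i) := by
    rw [← Equiv.sum_comp e, Fintype.sum_sum_type, Fin.sum_univ_succ fun i => t i / (z - a i)]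
    simp only [he, hwn, ht, ha, blockWeight, Fin.cons_zero, Fin.cons_succ, Sum.elim_inl,
      Sum.elim_inr, Finset.sum_div]
  have hprod' : ∏ i, (z - a i) = z * ∏ j, (z - ascEig A j) := by
    rw [Fin.prod_univ_succ]
    simp [ha]
  have hfinal : ∏ i, (z - ascEig (Fin.cons v A : Fin (k + 1) → Fin n → ℂ) i) =
      (∏ i, (z - a i)) * (1 - ∑ i, t i / (z - a i)) := by
    refine mul_left_cancel₀ (pow_ne_zero n hz0) ?_
    have hzn : z ^ n = z ^ (r + 1) * z ^ k := by rw [← pow_add, ← hr]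
    rw [hreal, hprod, hsum, hprod', hzn]
    ring
  show eval z _ = eval z _
  rw [eval_prod]
  simp only [eval_sub, eval_prod, eval_X, eval_C, eval_finsetSum, eval_mul]
  rw [hfinal, mul_sub, mul_one, Finset.mul_sum]
  congr 1
  refine Finset.sum_congr rfl fun i _ => ?_
  rw [← Finset.mul_prod_erase _ _ (Finset.mem_univ i)]
  field_simp [hza i]

/-- The weights of the secular equation are independent. The kernel, of dimension `r + 1`,
contributes a Gamma variable of shape `r + 1`, every other eigenvector an exponential variable. -/
theorem blockWeight_law {n r k : ℕ} (e : Fin (r + 1) ⊕ Fin k ≃ Fin n)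
    {U : Matrix (Fin n) (Fin n) ℂ} (hU : U ∈ Matrix.unitaryGroup (Fin n) ℂ) :
    Measurable (fun v => blockWeight e (U *ᵥ v)) ∧
    (Measure.pi fun _ : Fin n => complexNormal).map (fun v => blockWeight e (U *ᵥ v)) =
      Measure.pi fun i : Fin (k + 1) => gammaLaw ((Fin.cons r fun _ => 0 : Fin (k + 1) → ℕ) i) := by
  have hUm : Measurable fun v : Fin n → ℂ => U *ᵥ v := (measurePreserving_mulVec_volume hU).measurable
  have hsq : Measurable fun z : ℂ => ‖z‖ ^ 2 := by fun_prop
  have hs1 : (Measure.pi fun _ : Fin n => complexNormal).map (fun w i => ‖w i‖ ^ 2) =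
      Measure.pi fun _ : Fin n => gammaLaw 0 := by
    have : ∀ _ : Fin n, SigmaFinite (complexNormal.map fun z => ‖z‖ ^ 2) := fun _ => by
      rw [map_normSq_complexNormal]
      infer_instance
    rw [Measure.pi_map_pi fun _ => hsq.aemeasurable]
    simp only [map_normSq_complexNormal]
  have hs2 := (measurePreserving_piCongrLeft (fun _ : Fin n => gammaLaw 0) e).symm
  have hs3 := measurePreserving_sumPiEquivProdPi fun _ : Fin (r + 1) ⊕ Fin k => gammaLaw 0
  have hs4 : MeasurePreserving
      (fun p : (Fin (r + 1) → ℝ) × (Fin k → ℝ) => ((∑ i, p.1 i, p.2) : ℝ × (Fin k → ℝ)))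
      ((Measure.pi fun _ => gammaLaw 0).prod (Measure.pi fun _ => gammaLaw 0))
      ((gammaLaw r).prod (Measure.pi fun _ => gammaLaw 0)) :=
    MeasurePreserving.prod ⟨by fun_prop, map_sum_pi_gammaLaw r⟩ (MeasurePreserving.id _)
  have hs5 := measurePreserving_finCons
    fun i : Fin (k + 1) => gammaLaw ((Fin.cons r fun _ => 0 : Fin (k + 1) → ℕ) i)
  have hall := hs5.comp (hs4.comp (hs3.comp (hs2.comp
    ((⟨by fun_prop, hs1⟩ : MeasurePreserving (fun (w : Fin n → ℂ) i => ‖w i‖ ^ 2) _ _).comp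
      (⟨hUm, map_mulVec_pi_complexNormal hU⟩ : MeasurePreserving _ _ _)))))
  exact ⟨hall.measurable, hall.map_eq⟩

end RankOneUpdate

/-! ### The conditional law of the eigenvalues after adding a row -/

section AddingARow

@[fun_prop]
theorem continuous_det_vandermonde {k : ℕ} :
    Continuous fun x : Fin k → ℝ => (Matrix.vandermonde x).det := by
  simp only [Matrix.det_vandermonde]
  fun_prop

theorem measurableSet_interlaces {k : ℕ} :
    MeasurableSet {p : (Fin k → ℝ) × (Fin k → ℝ) | Interlaces p.1 p.2} := by
  have h : {p : (Fin k → ℝ) × (Fin k → ℝ) | Interlaces p.1 p.2} =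
      (⋂ i, {p | p.1 i < p.2 i}) ∩ ⋂ i, ⋂ j, {p | i < j → p.2 i < p.1 j} := by
    ext p
    simp [Interlaces]
  rw [h]
  refine (MeasurableSet.iInter fun i => measurableSet_lt (by fun_prop) (by fun_prop)).inter
    (MeasurableSet.iInter fun i => MeasurableSet.iInter fun j => ?_)
  by_cases hij : i < j
  · simp only [hij, true_imp_iff]
    exact measurableSet_lt (by fun_prop) (by fun_prop)
  · simp [hij]

theorem prod_erase_zero {k : ℕ} (f : Fin (k + 1) → ℝ) :
    ∏ j ∈ Finset.univ.erase 0, f j = ∏ i : Fin k, f i.succ := by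
  rw [Fin.univ_succ, Finset.erase_cons, Finset.prod_map]
  rfl

/-- The weight at the node `0`, which collects the components of the new row along the kernel. -/
theorem secularWeight_cons_zero {k : ℕ} (l : Fin k → ℝ) (μ : Fin (k + 1) → ℝ) :
    secularWeight (Fin.cons 0 l) μ 0 = (∏ j, μ j) / ∏ j, l j := by
  rw [secularWeight, prod_erase_zero]
  simp only [Fin.cons_zero, Fin.cons_succ, zero_sub, Finset.prod_neg, Finset.card_univ,
    Fintype.card_fin]
  have : (-1 : ℝ) ^ k ≠ 0 := pow_ne_zero _ (by norm_num)
  rw [pow_succ, mul_neg_one, neg_mul, neg_neg, mul_div_mul_left _ _ this]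

theorem det_vandermonde_cons_zero {k : ℕ} (l : Fin k → ℝ) :
    (Matrix.vandermonde (Fin.cons 0 l : Fin (k + 1) → ℝ)).det =
      (∏ i, l i) * (Matrix.vandermonde l).det := by
  rw [Matrix.det_vandermonde, Fin.prod_univ_succ, Matrix.det_vandermonde]
  simp [Fin.prod_Ioi_succ]

theorem strictMono_cons_zero {k : ℕ} {l : Fin k → ℝ} (hl : StrictMono l) (h0 : ∀ i, 0 < l i) :
    StrictMono (Fin.cons 0 l : Fin (k + 1) → ℝ) := by
  intro i j
  refine Fin.cases (fun hij => ?_) (fun j hij => ?_) j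
  · exact absurd hij (Fin.not_lt_zero i)
  · revert hij
    refine Fin.cases (fun _ => by simpa using h0 j) (fun i hij => ?_) i
    simpa using hl (Fin.succ_lt_succ_iff.1 hij)

/-- The conditional density of the `k + 1` eigenvalues `μ` of `A' A'†`, where `A'` is `A` with one
more row, given the `k` eigenvalues `l` of `A A†`; here `A` has `k + r + 1` columns. -/
noncomputable def stepDensity {k : ℕ} (r : ℕ) (l : Fin k → ℝ) (μ : Fin (k + 1) → ℝ) : ENNReal :=
  {p : (Fin (k + 1) → ℝ) × (Fin (k + 1) → ℝ) | Interlaces p.1 p.2}.indicator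
    (fun _ => ENNReal.ofReal (((∏ j, μ j) / ∏ j, l j) ^ r / (r ! : ℝ) *
      Real.exp (-(∑ j, μ j - ∑ j, l j)) *
        ((Matrix.vandermonde μ).det / ((∏ j, l j) * (Matrix.vandermonde l).det))))
    (Fin.cons 0 l, μ)

theorem stepDensity_of_interlaces {k r : ℕ} {l : Fin k → ℝ} {μ : Fin (k + 1) → ℝ}
    (h : Interlaces (Fin.cons 0 l : Fin (k + 1) → ℝ) μ) :
    stepDensity r l μ = ENNReal.ofReal (((∏ j, μ j) / ∏ j, l j) ^ r / (r ! : ℝ) *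
      Real.exp (-(∑ j, μ j - ∑ j, l j)) *
        ((Matrix.vandermonde μ).det / ((∏ j, l j) * (Matrix.vandermonde l).det))) :=
  Set.indicator_of_mem (Set.mem_ofPred_eq .. ▸ h) _

theorem stepDensity_of_not_interlaces {k r : ℕ} {l : Fin k → ℝ} {μ : Fin (k + 1) → ℝ}
    (h : ¬ Interlaces (Fin.cons 0 l : Fin (k + 1) → ℝ) μ) : stepDensity r l μ = 0 :=
  Set.indicator_of_notMem (fun h' => h (by simpa using h')) _

theorem measurable_finCons_zero {k : ℕ} :
    Measurable fun l : Fin k → ℝ => (Fin.cons 0 l : Fin (k + 1) → ℝ) := by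
  refine measurable_pi_lambda _ fun i => ?_
  refine Fin.cases ?_ (fun i => ?_) i
  · simp
  · simpa using measurable_pi_apply i

theorem measurable_stepDensity {k : ℕ} (r : ℕ) :
    Measurable fun p : (Fin k → ℝ) × (Fin (k + 1) → ℝ) => stepDensity r p.1 p.2 := by
  have hs : MeasurableSet {p : (Fin k → ℝ) × (Fin (k + 1) → ℝ) |
      Interlaces (Fin.cons 0 p.1 : Fin (k + 1) → ℝ) p.2} :=
    measurableSet_interlaces.preimage
      ((measurable_finCons_zero.comp measurable_fst).prodMk measurable_snd)
  have hv1 : Measurable fun p : (Fin k → ℝ) × (Fin (k + 1) → ℝ) => (Matrix.vandermonde p.1).det :=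
    continuous_det_vandermonde.measurable.comp measurable_fst
  have hv2 : Measurable fun p : (Fin k → ℝ) × (Fin (k + 1) → ℝ) => (Matrix.vandermonde p.2).det :=
    continuous_det_vandermonde.measurable.comp measurable_snd
  exact Measurable.indicator (f := fun p : (Fin k → ℝ) × (Fin (k + 1) → ℝ) =>
    ENNReal.ofReal (((∏ j, p.2 j) / ∏ j, p.1 j) ^ r / (r ! : ℝ) *
      Real.exp (-(∑ j, p.2 j - ∑ j, p.1 j)) *
        ((Matrix.vandermonde p.2).det / ((∏ j, p.1 j) * (Matrix.vandermonde p.1).det))))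
    (by fun_prop) hs

theorem prod_gammaDensity_cons {k r : ℕ} {t : Fin (k + 1) → ℝ} (ht : ∀ i, 0 < t i) :
    ∏ i, gammaDensity ((Fin.cons r fun _ => 0 : Fin (k + 1) → ℕ) i) (t i) =
      ENNReal.ofReal (t 0 ^ r / (r ! : ℝ) * Real.exp (-∑ i, t i)) := by
  have h0 := ht 0
  rw [Finset.prod_congr rfl fun i _ => gammaDensity_of_pos (ht i),
    ← ENNReal.ofReal_prod_of_nonneg fun i _ => by have := ht i; positivity]
  congr 1
  rw [Fin.prod_univ_succ, Fin.sum_univ_succ]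
  simp only [Fin.cons_zero, Fin.cons_succ, pow_zero, one_mul, Nat.factorial_zero, Nat.cast_one,
    div_one]
  rw [← Real.exp_sum, neg_add, Real.exp_add, Finset.sum_neg_distrib]
  ring

theorem ae_gammaLaw_pos (s : ℕ) : ∀ᵐ t ∂gammaLaw s, 0 < t := by
  rw [gammaLaw, ae_withDensity_iff (by fun_prop)]
  refine Filter.Eventually.of_forall fun t ht => ?_
  by_contra h
  exact ht (gammaDensity_of_nonpos (not_lt.1 h))

/-- The law of the eigenvalues after adding a random row `v` to a fixed `A`: the weights of the
secular equation have the product law of `blockWeight_law`, and the eigenvalues are its roots. -/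
theorem map_ascEig_cons {k n r : ℕ} (hr : n = (r + 1) + k) (A : Fin k → Fin n → ℂ)
    (hl : StrictMono (ascEig A)) (h0 : ∀ i, 0 < ascEig A i) :
    (Measure.pi fun _ : Fin n => complexNormal).map
        (fun v => ascEig (Fin.cons v A : Fin (k + 1) → Fin n → ℂ)) =
      volume.withDensity (stepDensity r (ascEig A)) := by
  obtain ⟨U, hU, e, hchar⟩ := exists_unitary_prod_X_sub_C_ascEig_cons hr A
  obtain ⟨htm, htlaw⟩ := blockWeight_law e hU
  set l := ascEig A with hldef
  set a : Fin (k + 1) → ℝ := Fin.cons 0 l with ha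
  set s : Fin (k + 1) → ℕ := Fin.cons r fun _ => 0 with hs
  set t : (Fin n → ℂ) → Fin (k + 1) → ℝ := fun v => blockWeight e (U *ᵥ v) with ht
  have hamono : StrictMono a := strictMono_cons_zero hl h0
  set I : Set (Fin (k + 1) → ℝ) := {μ | Interlaces a μ} with hI
  have hIm : MeasurableSet I := measurableSet_interlaces.preimage (by fun_prop : Measurable fun
    μ : Fin (k + 1) → ℝ => (a, μ))
  have hconsm : Measurable fun v : Fin n → ℂ => (Fin.cons v A : Fin (k + 1) → Fin n → ℂ) := by
    refine measurable_pi_lambda _ fun i => ?_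
    refine Fin.cases ?_ (fun i => ?_) i
    · exact measurable_id
    · simp
  have hascm : Measurable fun v : Fin n → ℂ =>
      ascEig (Fin.cons v A : Fin (k + 1) → Fin n → ℂ) := measurable_ascEig.comp hconsm
  have hpos : ∀ᵐ v ∂(Measure.pi fun _ : Fin n => complexNormal), ∀ i, 0 < t v i := by
    refine ae_of_ae_map (f := t) (p := fun t => ∀ i, 0 < t i) htm.aemeasurable ?_
    rw [htlaw]
    exact ae_all_iff.2 fun i => Measure.tendsto_eval_ae_ae.eventually (ae_gammaLaw_pos (s i))
  have hroots : ∀ᵐ v ∂(Measure.pi fun _ : Fin n => complexNormal),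
      Interlaces a (ascEig (Fin.cons v A : Fin (k + 1) → Fin n → ℂ)) ∧
        secularWeight a (ascEig (Fin.cons v A : Fin (k + 1) → Fin n → ℂ)) = t v := by
    filter_upwards [hpos] with v hv
    obtain ⟨μ, hμ, hμt⟩ := exists_interlaces_secularWeight_eq hamono hv
    have heq : ascEig (Fin.cons v A : Fin (k + 1) → Fin n → ℂ) = μ := by
      refine eq_of_monotone_of_prod_X_sub_C_eq (monotone_ascEig _) hμ.strictMono_right.monotone ?_
      rw [hchar v, (prod_X_sub_C_eq_iff (μ := μ) hamono.injective (t v)).2 hμt.symm]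
    rw [heq]
    exact ⟨hμ, hμt⟩
  have hdiff : ∀ μ, HasFDerivAt (secularWeight a)
      (Matrix.toLin' (secularJacobian a μ)).toContinuousLinearMap μ := hasFDerivAt_secularWeight a
  have hcont : Continuous (secularWeight a) :=
    continuous_iff_continuousAt.2 fun μ => (hdiff μ).continuousAt
  refine Measure.ext fun S hS => ?_
  have hSI := hS.inter hIm
  have hinj : Set.InjOn (secularWeight a) (S ∩ I) :=
    injOn_secularWeight.mono Set.inter_subset_right
  have himm : MeasurableSet (secularWeight a '' (S ∩ I)) :=
    hSI.image_of_continuousOn_injOn hcont.continuousOn hinj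
  have : ∀ i, SigmaFinite ((volume : Measure ℝ).withDensity (gammaDensity (s i))) := fun i =>
    inferInstanceAs (SigmaFinite (gammaLaw (s i)))
  have htau : (Measure.pi fun i => gammaLaw (s i)) =
      volume.withDensity fun t : Fin (k + 1) → ℝ => ∏ i, gammaDensity (s i) (t i) := by
    unfold gammaLaw
    rw [pi_withDensity (fun _ => volume) (fun i => measurable_gammaDensity (s i)), volume_pi]
  calc (Measure.pi fun _ : Fin n => complexNormal).map
        (fun v => ascEig (Fin.cons v A : Fin (k + 1) → Fin n → ℂ)) S
      = (Measure.pi fun _ : Fin n => complexNormal) (t ⁻¹' (secularWeight a '' (S ∩ I))) := by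
        rw [Measure.map_apply hascm hS]
        refine measure_congr ?_
        filter_upwards [hroots] with v hv
        refine propext ⟨fun h => ⟨_, ⟨h, hv.1⟩, hv.2⟩, ?_⟩
        rintro ⟨μ, ⟨hμS, hμI⟩, hμt⟩
        have : μ = ascEig (Fin.cons v A : Fin (k + 1) → Fin n → ℂ) :=
          injOn_secularWeight hμI hv.1 (hμt.trans hv.2.symm)
        show ascEig (Fin.cons v A : Fin (k + 1) → Fin n → ℂ) ∈ S
        rwa [← this]
    _ = ∫⁻ t in secularWeight a '' (S ∩ I), ∏ i, gammaDensity (s i) (t i) := by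
        rw [← Measure.map_apply htm himm, htlaw, htau, withDensity_apply _ himm]
    _ = ∫⁻ μ in S ∩ I, ENNReal.ofReal
          |(Matrix.toLin' (secularJacobian a μ)).toContinuousLinearMap.det| *
            ∏ i, gammaDensity (s i) (secularWeight a μ i) :=
        lintegral_image_eq_lintegral_abs_det_fderiv_mul volume hSI
          (fun μ _ => (hdiff μ).hasFDerivWithinAt) hinj _
    _ = ∫⁻ μ in S ∩ I, stepDensity r l μ := by
        refine setLIntegral_congr_fun hSI fun μ hμ => ?_
        have hμI : Interlaces a μ := hμ.2
        have hw := secularWeight_pos hμI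
        have hμ0 := det_vandermonde_pos hμI.strictMono_right
        have ha0 := det_vandermonde_pos hamono
        rw [abs_det_secularJacobian hamono hμI.strictMono_right, hs, prod_gammaDensity_cons hw,
          sum_secularWeight hamono.injective, ← ENNReal.ofReal_mul (div_pos hμ0 ha0).le,
          stepDensity_of_interlaces hμI]
        congr 1
        have hsum : ∑ i, a i = ∑ i, l i := by
          rw [Fin.sum_univ_succ]
          simp [ha]
        rw [hsum, ha, secularWeight_cons_zero, det_vandermonde_cons_zero]
        ring
    _ = volume.withDensity (stepDensity r l) S := by
        rw [withDensity_apply _ hS, Set.inter_comm, ← Measure.restrict_restrict hIm,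
          ← lintegral_indicator hIm]
        refine lintegral_congr fun μ => ?_
        by_cases hμ : μ ∈ I
        · rw [Set.indicator_of_mem hμ]
        · rw [Set.indicator_of_notMem hμ]
          exact (stepDensity_of_not_interlaces hμ).symm

end AddingARow

/-! ### The law of the ordered eigenvalues -/

section OrderedDensity

/-- The Laguerre ensemble density `c Δ(μ)² ∏ μᵢ^q e^{-μᵢ}` on the chamber `0 < μ₀ < μ₁ < ⋯`. -/
noncomputable def orderedDensity {k : ℕ} (q : ℕ) (c : ℝ) : (Fin k → ℝ) → ENNReal :=
  {μ | StrictMono μ ∧ ∀ i, 0 < μ i}.indicator fun μ =>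
    ENNReal.ofReal (c * ((Matrix.vandermonde μ).det ^ 2 * ∏ i, (μ i ^ q * Real.exp (-μ i))))

theorem orderedDensity_of_mem {k q : ℕ} {c : ℝ} {μ : Fin k → ℝ}
    (h : StrictMono μ ∧ ∀ i, 0 < μ i) : orderedDensity q c μ =
      ENNReal.ofReal (c * ((Matrix.vandermonde μ).det ^ 2 * ∏ i, (μ i ^ q * Real.exp (-μ i)))) :=
  Set.indicator_of_mem (Set.mem_ofPred_eq .. ▸ h) _

theorem orderedDensity_of_notMem {k q : ℕ} {c : ℝ} {μ : Fin k → ℝ}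
    (h : ¬ (StrictMono μ ∧ ∀ i, 0 < μ i)) : orderedDensity q c μ = 0 :=
  Set.indicator_of_notMem (fun h' => h (by simpa using h')) _

theorem measurableSet_chamber {k : ℕ} :
    MeasurableSet {μ : Fin k → ℝ | StrictMono μ ∧ ∀ i, 0 < μ i} := by
  have h : {μ : Fin k → ℝ | StrictMono μ ∧ ∀ i, 0 < μ i} =
      (⋂ i, ⋂ j, {μ | i < j → μ i < μ j}) ∩ ⋂ i, {μ | 0 < μ i} := by
    ext μ
    simp [StrictMono]
  rw [h]
  refine (MeasurableSet.iInter fun i => MeasurableSet.iInter fun j => ?_).inter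
    (MeasurableSet.iInter fun i => measurableSet_lt (by fun_prop) (by fun_prop))
  by_cases hij : i < j
  · simp only [hij, true_imp_iff]
    exact measurableSet_lt (by fun_prop) (by fun_prop)
  · simp [hij]

theorem measurable_orderedDensity {k : ℕ} (q : ℕ) (c : ℝ) :
    Measurable (orderedDensity q c : (Fin k → ℝ) → ENNReal) := by
  have := (continuous_det_vandermonde (k := k)).measurable
  exact Measurable.indicator (by fun_prop) measurableSet_chamber

/-- For a fixed `μ` in the chamber, the `l` for which `(0, l)` interlaces `μ` form a box. -/
theorem interlaces_cons_zero_iff {k : ℕ} {l : Fin k → ℝ} {μ : Fin (k + 1) → ℝ} :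
    Interlaces (Fin.cons 0 l : Fin (k + 1) → ℝ) μ ↔ (StrictMono μ ∧ ∀ i, 0 < μ i) ∧
      l ∈ Set.univ.pi fun i : Fin k => Set.Ioo (μ i.castSucc) (μ i.succ) := by
  constructor
  · intro h
    have h0 : 0 < μ 0 := by simpa using h.1 0
    refine ⟨⟨h.strictMono_right, fun i => h0.trans_le
      (h.strictMono_right.monotone (Fin.zero_le i))⟩, fun i _ => ⟨?_, ?_⟩⟩
    · simpa using h.2 i.castSucc i.succ Fin.castSucc_lt_succ
    · simpa using h.1 i.succ
  · rintro ⟨⟨hm, h0⟩, hl⟩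
    refine ⟨fun i => ?_, fun i j => ?_⟩
    · refine Fin.cases ?_ (fun i => ?_) i
      · simpa using h0 0
      · simpa using (hl i (Set.mem_univ i)).2
    · refine Fin.cases (fun hij => absurd hij (Fin.not_lt_zero i)) (fun j hij => ?_) j
      rw [Fin.cons_succ]
      exact (hm.monotone (Fin.le_castSucc_iff.2 hij)).trans_lt (hl j (Set.mem_univ j)).1

/-- The recursion of the densities: in the product one factor `Δ(l)` and all powers of `∏ l i`
cancel, so that only `Δ(l)` is to be integrated over the box of the `l` interlacing `μ`. -/
theorem lintegral_orderedDensity_mul_stepDensity {k : ℕ} (r : ℕ) {c : ℝ} (hc : 0 ≤ c)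
    (μ : Fin (k + 1) → ℝ) :
    ∫⁻ l : Fin k → ℝ, orderedDensity (r + 1) c l * stepDensity r l μ =
      orderedDensity r (c * ((k ! : ℝ) * (r ! : ℝ))⁻¹) μ := by
  by_cases hμ : StrictMono μ ∧ ∀ i, 0 < μ i
  swap
  · have : ∀ l : Fin k → ℝ, stepDensity r l μ = 0 := fun l =>
      stepDensity_of_not_interlaces fun h => hμ (interlaces_cons_zero_iff.1 h).1
    simp only [this, mul_zero, lintegral_zero]
    exact (orderedDensity_of_notMem hμ).symm
  have hbox : MeasurableSet (Set.univ.pi fun i : Fin k => Set.Ioo (μ i.castSucc) (μ i.succ)) :=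
    MeasurableSet.univ_pi fun _ => measurableSet_Ioo
  have hΔμ := det_vandermonde_pos hμ.1
  have hPμ : 0 < ∏ i, μ i := Finset.prod_pos fun i _ => hμ.2 i
  set K : ℝ := c * ((r ! : ℝ))⁻¹ * (∏ i, μ i) ^ r * Real.exp (-∑ i, μ i) *
    (Matrix.vandermonde μ).det with hK
  have hK0 : 0 ≤ K := by positivity
  have h1 : ∀ l : Fin k → ℝ, orderedDensity (r + 1) c l * stepDensity r l μ =
      (Set.univ.pi fun i : Fin k => Set.Ioo (μ i.castSucc) (μ i.succ)).indicator
        (fun l => ENNReal.ofReal K * ENNReal.ofReal (Matrix.vandermonde l).det) l := by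
    intro l
    by_cases hl : l ∈ Set.univ.pi fun i : Fin k => Set.Ioo (μ i.castSucc) (μ i.succ)
    swap
    · rw [Set.indicator_of_notMem hl, stepDensity_of_not_interlaces, mul_zero]
      exact fun h => hl (interlaces_cons_zero_iff.1 h).2
    have hI : Interlaces (Fin.cons 0 l : Fin (k + 1) → ℝ) μ := interlaces_cons_zero_iff.2 ⟨hμ, hl⟩
    have hlm : StrictMono l := fun i j hij => by
      simpa using hI.strictMono_left (Fin.succ_lt_succ_iff.2 hij)
    have hl0 : ∀ i, 0 < l i := fun i => by
      simpa using hI.strictMono_left (Fin.succ_pos i)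
    have hΔl := det_vandermonde_pos hlm
    have hPl : 0 < ∏ i, l i := Finset.prod_pos fun i _ => hl0 i
    rw [Set.indicator_of_mem hl, orderedDensity_of_mem ⟨hlm, hl0⟩, stepDensity_of_interlaces hI,
      ← ENNReal.ofReal_mul hK0, ← ENNReal.ofReal_mul (mul_nonneg hc (mul_nonneg (sq_nonneg _)
        (Finset.prod_nonneg fun i _ => by have := hl0 i; positivity)))]
    congr 1
    rw [Finset.prod_mul_distrib, Finset.prod_pow, ← Real.exp_sum, Finset.sum_neg_distrib, hK,
      neg_sub, sub_eq_add_neg, Real.exp_add]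
    have hexp : Real.exp (-∑ i, l i) = (Real.exp (∑ i, l i))⁻¹ := by
      rw [Real.exp_neg]
    rw [hexp, div_pow]
    field_simp
    rw [pow_succ, mul_assoc]
  simp only [h1]
  rw [lintegral_indicator hbox, lintegral_const_mul _ (by
      have := (continuous_det_vandermonde (k := k)).measurable
      fun_prop), lintegral_box_det_vandermonde hμ.1, ← ENNReal.ofReal_mul hK0,
    orderedDensity_of_mem hμ]
  congr 1
  rw [Finset.prod_mul_distrib, Finset.prod_pow, ← Real.exp_sum, Finset.sum_neg_distrib, hK]
  field_simp

/-- The normalizing constant of the ordered Laguerre ensemble of `k` rows and `n` columns. -/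
noncomputable def laguerreConst (n k : ℕ) : ℝ :=
  ∏ j ∈ Finset.range k, ((j ! : ℝ) * ((n - 1 - j)! : ℝ))⁻¹

theorem laguerreConst_nonneg (n k : ℕ) : 0 ≤ laguerreConst n k :=
  Finset.prod_nonneg fun _ _ => by positivity

/-- The law of the ordered eigenvalues of `A A†`, by induction on the number of rows of `A`. -/
theorem map_ascEig {n : ℕ} (k q : ℕ) (hn : n = q + k) :
    (Measure.pi fun _ : Fin k => Measure.pi fun _ : Fin n => complexNormal).map ascEig =
      volume.withDensity (orderedDensity q (laguerreConst n k)) := by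
  induction k generalizing q with
  | zero =>
    have h1 : (orderedDensity q (laguerreConst n 0) : (Fin 0 → ℝ) → ENNReal) = fun _ => 1 := by
      funext μ
      rw [orderedDensity_of_mem ⟨Subsingleton.strictMono μ, fun i => i.elim0⟩]
      simp [laguerreConst]
    rw [h1, withDensity_const, one_smul, Measure.volume_pi_eq_dirac 0,
      Measure.pi_of_empty _ (0 : Fin 0 → Fin n → ℂ), Measure.map_dirac' measurable_ascEig]
    congr 1
    exact Subsingleton.elim _ _
  | succ k ih =>
    have hr : n = (q + 1) + k := by omega
    have ih := ih (q + 1) hr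
    set γ : Measure (Fin n → ℂ) := Measure.pi fun _ : Fin n => complexNormal with hγ
    have hcons := measurePreserving_finCons fun _ : Fin (k + 1) => γ
    have hgood : ∀ᵐ A ∂(Measure.pi fun _ : Fin k => γ),
        StrictMono (ascEig A) ∧ ∀ i, 0 < ascEig A i := by
      refine ae_of_ae_map (f := ascEig) (p := fun l => StrictMono l ∧ ∀ i, 0 < l i)
        measurable_ascEig.aemeasurable ?_
      rw [ih, ae_withDensity_iff (measurable_orderedDensity _ _)]
      refine Filter.Eventually.of_forall fun l hl => ?_
      by_contra h
      exact hl (orderedDensity_of_notMem h)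
    refine Measure.ext_of_lintegral _ fun F hF => ?_
    have hFm : Measurable fun A : Fin (k + 1) → Fin n → ℂ => F (ascEig A) :=
      hF.comp measurable_ascEig
    have hSm := measurable_stepDensity (k := k) q
    have hHm : Measurable fun l : Fin k → ℝ => ∫⁻ μ, stepDensity q l μ * F μ :=
      Measurable.lintegral_prod_right' (f := fun p : (Fin k → ℝ) × (Fin (k + 1) → ℝ) =>
        stepDensity q p.1 p.2 * F p.2) (by fun_prop)
    rw [lintegral_map hF measurable_ascEig, ← hcons.lintegral_comp hFm,
      lintegral_prod_symm' (fun p : (Fin n → ℂ) × (Fin k → Fin n → ℂ) =>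
        F (ascEig (Fin.cons p.1 p.2 : Fin (k + 1) → Fin n → ℂ))) (hFm.comp hcons.measurable)]
    calc ∫⁻ A, (∫⁻ v, F (ascEig (Fin.cons v A : Fin (k + 1) → Fin n → ℂ)) ∂γ)
          ∂(Measure.pi fun _ : Fin k => γ)
        = ∫⁻ A, (∫⁻ μ, stepDensity q (ascEig A) μ * F μ) ∂(Measure.pi fun _ : Fin k => γ) := by
          refine lintegral_congr_ae ?_
          filter_upwards [hgood] with A hA
          have hm : Measurable fun v => ascEig (Fin.cons v A : Fin (k + 1) → Fin n → ℂ) :=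
            measurable_ascEig.comp (hcons.measurable.comp (by fun_prop :
              Measurable fun v : Fin n → ℂ => (v, A)))
          rw [← lintegral_map hF hm, map_ascEig_cons hr A hA.1 hA.2,
            lintegral_withDensity_eq_lintegral_mul _ (by fun_prop) hF]
          simp only [Pi.mul_apply]
      _ = ∫⁻ l, (∫⁻ μ, stepDensity q l μ * F μ)
            ∂(volume.withDensity (orderedDensity (q + 1) (laguerreConst n k))) := by
          rw [← ih, lintegral_map hHm measurable_ascEig]
      _ = ∫⁻ l, ∫⁻ μ, orderedDensity (q + 1) (laguerreConst n k) l *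
            (stepDensity q l μ * F μ) := by
          rw [lintegral_withDensity_eq_lintegral_mul _ (measurable_orderedDensity _ _) hHm]
          refine lintegral_congr fun l => ?_
          rw [Pi.mul_apply, lintegral_const_mul]
          exact (hSm.comp (by fun_prop : Measurable fun μ : Fin (k + 1) → ℝ => (l, μ))).mul hF
      _ = ∫⁻ μ, ∫⁻ l, orderedDensity (q + 1) (laguerreConst n k) l *
            (stepDensity q l μ * F μ) := by
          have := measurable_orderedDensity (k := k) (q + 1) (laguerreConst n k)
          exact lintegral_lintegral_swap (by fun_prop)
      _ = ∫⁻ μ, F μ ∂(volume.withDensity (orderedDensity q (laguerreConst n (k + 1)))) := by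
          rw [lintegral_withDensity_eq_lintegral_mul _ (measurable_orderedDensity _ _) hF]
          refine lintegral_congr fun μ => ?_
          have h1 : Measurable fun l : Fin k → ℝ =>
              orderedDensity (q + 1) (laguerreConst n k) l * stepDensity q l μ :=
            (measurable_orderedDensity (q + 1) (laguerreConst n k)).mul
              (Measurable.of_uncurry_right hSm)
          simp only [← mul_assoc]
          have hconst : laguerreConst n (k + 1) =
              laguerreConst n k * ((k ! : ℝ) * (q ! : ℝ))⁻¹ := by
            rw [laguerreConst, laguerreConst, Finset.prod_range_succ, show n - 1 - k = q by omega]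
          rw [lintegral_mul_const _ h1, hconst, Pi.mul_apply]
          exact congrArg (· * F μ)
            (lintegral_orderedDensity_mul_stepDensity q (laguerreConst_nonneg n k) μ)

end OrderedDensity

/-! ### Orthogonality of the Laguerre polynomials -/

section Laguerre

theorem gammaLaw_eq_restrict (s : ℕ) : gammaLaw s = (volume.restrict (Set.Ioi 0)).withDensity
    fun t => ENNReal.ofReal (t ^ s * Real.exp (-t) / (s ! : ℝ)) := by
  rw [gammaLaw, ← withDensity_indicator measurableSet_Ioi]
  rfl

theorem moment_gammaLaw (s j : ℕ) : Integrable (fun t : ℝ => t ^ j) (gammaLaw s) ∧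
    ∫ t, t ^ j ∂gammaLaw s = ((s + j)! : ℝ) / (s ! : ℝ) := by
  have hm : Measurable fun t : ℝ => ENNReal.ofReal (t ^ s * Real.exp (-t) / (s ! : ℝ)) := by fun_prop
  have hlt : ∀ᵐ t ∂volume.restrict (Set.Ioi (0 : ℝ)),
      ENNReal.ofReal (t ^ s * Real.exp (-t) / (s ! : ℝ)) < ⊤ :=
    Filter.Eventually.of_forall fun _ => ENNReal.ofReal_lt_top
  have hG := Real.GammaIntegral_convergent (s := ((s + j : ℕ) : ℝ) + 1) (by positivity)
  have heq : Set.EqOn (fun t : ℝ => Real.exp (-t) * t ^ (((s + j : ℕ) : ℝ) + 1 - 1) / (s ! : ℝ))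
      (fun t => (ENNReal.ofReal (t ^ s * Real.exp (-t) / (s ! : ℝ))).toReal • t ^ j)
      (Set.Ioi 0) := by
    intro t ht
    have ht0 : (0 : ℝ) < t := ht
    simp only
    rw [ENNReal.toReal_ofReal (by positivity), add_sub_cancel_right, Real.rpow_natCast, pow_add,
      smul_eq_mul]
    ring
  rw [gammaLaw_eq_restrict]
  constructor
  · rw [integrable_withDensity_iff_integrable_smul' hm hlt]
    exact IntegrableOn.congr_fun (Integrable.div_const hG _) heq measurableSet_Ioi
  · rw [integral_withDensity_eq_integral_toReal_smul hm hlt,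
      ← setIntegral_congr_fun measurableSet_Ioi heq, integral_div,
      ← Real.Gamma_eq_integral (by positivity), Real.Gamma_nat_eq_factorial]

theorem laguerreL_eq_sum_mul (ν k : ℕ) (x : ℝ) : laguerreL ν k x =
    ∑ i ∈ Finset.range (k + 1), ((-1 : ℝ) ^ i * ((k + ν).choose (k - i) : ℝ) / (i ! : ℝ)) * x ^ i :=
  Finset.sum_congr rfl fun _ _ => by ring

/-- The coefficients of `L_k^ν`, paired with the moments of the Gamma distribution, form a `k`-th
finite difference of the polynomial `(x + 1) ⋯ (x + j)`. -/
theorem integral_pow_mul_laguerreL (ν k j : ℕ) :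
    Integrable (fun x => x ^ j * laguerreL ν k x) (gammaLaw ν) ∧
    ∫ x, x ^ j * laguerreL ν k x ∂gammaLaw ν =
      ((k + ν)! : ℝ) / ((k ! : ℝ) * (ν ! : ℝ)) * (-1) ^ k *
        (fwdDiff 1)^[k] (ascPochhammer ℝ j).eval ((ν + 1 : ℕ) : ℝ) := by
  have h1 : (fun x => x ^ j * laguerreL ν k x) = fun x => ∑ i ∈ Finset.range (k + 1),
      ((-1 : ℝ) ^ i * ((k + ν).choose (k - i) : ℝ) / (i ! : ℝ)) * x ^ (i + j) := by
    funext x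
    rw [laguerreL_eq_sum_mul, Finset.mul_sum]
    exact Finset.sum_congr rfl fun _ _ => by ring
  have hi : ∀ i ∈ Finset.range (k + 1), Integrable (fun x : ℝ =>
      ((-1 : ℝ) ^ i * ((k + ν).choose (k - i) : ℝ) / (i ! : ℝ)) * x ^ (i + j)) (gammaLaw ν) :=
    fun i _ => (moment_gammaLaw ν (i + j)).1.const_mul _
  rw [h1]
  refine ⟨integrable_finsetSum _ hi, ?_⟩
  rw [integral_finsetSum _ hi, fwdDiff_iter_eq_sum_shift, Finset.mul_sum]
  refine Finset.sum_congr rfl fun i hi => ?_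
  obtain ⟨l, rfl⟩ := Nat.exists_eq_add_of_le (Nat.lt_succ_iff.1 (Finset.mem_range.1 hi))
  rw [integral_const_mul, (moment_gammaLaw ν (i + j)).2]
  have hP : (ascPochhammer ℝ j).eval (((ν + 1 : ℕ) : ℝ) + i • (1 : ℝ)) * ((ν + i)! : ℝ) =
      ((ν + (i + j))! : ℝ) := by
    have : ((ν + 1 : ℕ) : ℝ) + i • (1 : ℝ) = ((ν + i + 1 : ℕ) : ℝ) := by
      push_cast
      simp
      ring
    rw [this, ascPochhammer_nat_eq_natCast_ascFactorial, mul_comm]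
    have := Nat.factorial_mul_ascFactorial (ν + i) j
    rw [add_assoc ν i j] at this
    exact_mod_cast this
  have hc1 : ((i + l + ν).choose l : ℝ) * (l ! : ℝ) * ((ν + i)! : ℝ) = ((i + l + ν)! : ℝ) := by
    have := Nat.choose_mul_factorial_mul_factorial (n := i + l + ν) (k := l) (by omega)
    rw [show i + l + ν - l = ν + i by omega] at this
    exact_mod_cast this
  have hc2 : ((i + l).choose i : ℝ) * (i ! : ℝ) * (l ! : ℝ) = ((i + l)! : ℝ) := by
    have := Nat.choose_mul_factorial_mul_factorial (n := i + l) (k := i) (by omega)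
    rw [show i + l - i = l by omega] at this
    exact_mod_cast this
  rw [show i + l - i = l by omega, zsmul_eq_mul, ← hP, ← hc1, ← hc2]
  have hs : ((-1 : ℝ)) ^ (i + l) * (-1) ^ l = (-1) ^ i := by
    rw [pow_add, mul_assoc, ← mul_pow]
    simp
  have hi0 : (i ! : ℝ) ≠ 0 := by positivity
  have hl0 : (l ! : ℝ) ≠ 0 := by positivity
  have hν0 : (ν ! : ℝ) ≠ 0 := by positivity
  have hch : ((i + l).choose i : ℝ) ≠ 0 := by
    have := Nat.choose_pos (n := i + l) (k := i) (by omega)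
    positivity
  push_cast
  rw [← hs]
  field_simp

/-- The `k`-th difference kills polynomials of degree less than `k`, so `L_k^ν` is orthogonal to
these; for degree `k` it gives `k!` times the leading coefficient. -/
theorem integral_laguerreL_mul_of_le {ν k l : ℕ} (hlk : l ≤ k) :
    ∫ x, laguerreL ν l x * laguerreL ν k x ∂gammaLaw ν =
      if l = k then ((k + ν)! : ℝ) / ((k ! : ℝ) * (ν ! : ℝ)) else 0 := by
  have h1 : (fun x => laguerreL ν l x * laguerreL ν k x) = fun x => ∑ i ∈ Finset.range (l + 1),
      ((-1 : ℝ) ^ i * ((l + ν).choose (l - i) : ℝ) / (i ! : ℝ)) * (x ^ i * laguerreL ν k x) := by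
    funext x
    rw [laguerreL_eq_sum_mul ν l, Finset.sum_mul]
    exact Finset.sum_congr rfl fun _ _ => by ring
  rw [h1, integral_finsetSum _ fun i _ => (integral_pow_mul_laguerreL ν k i).1.const_mul _]
  simp only [integral_const_mul, (integral_pow_mul_laguerreL ν k _).2]
  have hzero : ∀ i, i < k →
      (fwdDiff 1)^[k] (ascPochhammer ℝ i).eval ((ν + 1 : ℕ) : ℝ) = 0 := by
    intro i hi
    rw [Polynomial.fwdDiff_iter_eq_zero_of_degree_lt (by rwa [ascPochhammer_natDegree])]
    rfl
  rw [Finset.sum_range_succ, Finset.sum_eq_zero fun i hi => by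
    rw [hzero i (lt_of_lt_of_le (Finset.mem_range.1 hi) hlk)]; ring, zero_add]
  split_ifs with h
  · subst h
    have htop : (fwdDiff 1)^[l] (ascPochhammer ℝ l).eval ((ν + 1 : ℕ) : ℝ) = (l ! : ℝ) := by
      have := Polynomial.fwdDiff_iter_degree_eq_factorial (ascPochhammer ℝ l)
      rw [ascPochhammer_natDegree, (monic_ascPochhammer ℝ l).leadingCoeff, one_smul] at this
      rw [this]
      rfl
    rw [htop, Nat.sub_self, Nat.choose_zero_right]
    have hs : ((-1 : ℝ)) ^ l * (-1) ^ l = 1 := by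
      rw [← mul_pow]
      simp
    have hl0 : (l ! : ℝ) ≠ 0 := by positivity
    field_simp
    rw [sq, hs]
    simp
  · rw [hzero l (lt_of_le_of_ne hlk h)]
    ring

/-- Orthogonality of the associated Laguerre polynomials. -/
theorem integral_laguerreL_mul (ν k l : ℕ) :
    ∫ x, laguerreL ν k x * laguerreL ν l x ∂gammaLaw ν =
      if k = l then ((k + ν)! : ℝ) / ((k ! : ℝ) * (ν ! : ℝ)) else 0 := by
  rcases le_total k l with h | h
  · rw [integral_laguerreL_mul_of_le h]
    split_ifs with hkl
    · rw [hkl]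
    · rfl
  · simp only [mul_comm (laguerreL ν k _)]
    rw [integral_laguerreL_mul_of_le h]
    simp only [eq_comm]

theorem integrable_laguerreL_mul (ν k l : ℕ) :
    Integrable (fun x => laguerreL ν k x * laguerreL ν l x) (gammaLaw ν) := by
  have h1 : (fun x => laguerreL ν k x * laguerreL ν l x) = fun x => ∑ i ∈ Finset.range (k + 1),
      ((-1 : ℝ) ^ i * ((k + ν).choose (k - i) : ℝ) / (i ! : ℝ)) * (x ^ i * laguerreL ν l x) := by
    funext x
    rw [laguerreL_eq_sum_mul ν k, Finset.sum_mul]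
    exact Finset.sum_congr rfl fun _ _ => by ring
  rw [h1]
  exact integrable_finsetSum _ fun i _ => (integral_pow_mul_laguerreL ν l i).1.const_mul _

/-- The passage from the monomials to the Laguerre polynomials is triangular, with the leading
coefficients `(-1)^j / j!` on the diagonal. -/
theorem det_laguerreL (ν : ℕ) {m : ℕ} (x : Fin m → ℝ) :
    (Matrix.of fun i j : Fin m => laguerreL ν j (x i)).det =
      (Matrix.vandermonde x).det * ∏ j : Fin m, ((-1 : ℝ) ^ (j : ℕ) / ((j : ℕ)! : ℝ)) := by
  set K : Matrix (Fin m) (Fin m) ℝ := Matrix.of fun l j =>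
    if l ≤ j then (-1 : ℝ) ^ (l : ℕ) * ((j + ν : ℕ).choose (j - l) : ℝ) / ((l : ℕ)! : ℝ) else 0
    with hK
  have h1 : (Matrix.of fun i j : Fin m => laguerreL ν j (x i)) = Matrix.vandermonde x * K := by
    ext i j
    rw [Matrix.of_apply, laguerreL_eq_sum_mul, Matrix.mul_apply]
    simp only [Matrix.vandermonde_apply, hK, Matrix.of_apply, Fin.le_def]
    rw [Fin.sum_univ_eq_sum_range (fun l => x i ^ l * (if l ≤ (j : ℕ) then
      (-1 : ℝ) ^ l * ((j + ν : ℕ).choose (j - l) : ℝ) / (l ! : ℝ) else 0)) m]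
    rw [← Finset.sum_subset (Finset.range_mono (Nat.succ_le_of_lt j.2))]
    · refine Finset.sum_congr rfl fun l hl => ?_
      rw [if_pos (Nat.lt_succ_iff.1 (Finset.mem_range.1 hl)), mul_comm]
    · intro l _ hl
      rw [if_neg (fun h => hl (Finset.mem_range.2 (Nat.lt_succ_iff.2 h))), mul_zero]
  have h2 : K.BlockTriangular id := fun i j hij => if_neg (not_le.2 hij)
  rw [h1, Matrix.det_mul, Matrix.det_of_isUpperTriangular h2]
  simp [hK]

end Laguerre

/-! ### Sums over permutations and over pairs of distinct indices -/

section Permutations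

/-- Any two distinct indices are the images of `0` and `1` under some permutation. -/
theorem exists_perm_zero_one {p : ℕ} {i j : Fin (p + 2)} (h : i ≠ j) :
    ∃ σ : Equiv.Perm (Fin (p + 2)), σ 0 = i ∧ σ 1 = j := by
  have h01 : (0 : Fin (p + 2)) ≠ 1 := by simp
  have hne : Equiv.swap 0 i j ≠ 0 := by
    rw [Ne, Equiv.swap_apply_eq_iff, Equiv.swap_apply_left]
    exact h.symm
  refine ⟨Equiv.swap 0 i * Equiv.swap 1 (Equiv.swap 0 i j), ?_, ?_⟩
  · rw [Equiv.Perm.mul_apply, Equiv.swap_apply_of_ne_of_ne h01 hne.symm, Equiv.swap_apply_left]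
  · rw [Equiv.Perm.mul_apply, Equiv.swap_apply_left, Equiv.swap_apply_self]

theorem perm_eq_one_or_swap {p : ℕ} {π : Equiv.Perm (Fin (p + 2))}
    (h : ∀ i : Fin p, π i.succ.succ = i.succ.succ) : π = 1 ∨ π = Equiv.swap 0 1 := by
  have h0 : π 0 = 0 ∨ π 0 = 1 := by
    rcases Fin.eq_zero_or_eq_succ (π 0) with h0 | ⟨a, ha⟩
    · exact Or.inl h0
    rcases Fin.eq_zero_or_eq_succ a with rfl | ⟨b, rfl⟩
    · exact Or.inr ha
    · have := π.injective (ha.trans (h b).symm)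
      exact absurd this.symm (Fin.succ_ne_zero _)
  have h1 : π 1 = 0 ∨ π 1 = 1 := by
    rcases Fin.eq_zero_or_eq_succ (π 1) with h0 | ⟨a, ha⟩
    · exact Or.inl h0
    rcases Fin.eq_zero_or_eq_succ a with rfl | ⟨b, rfl⟩
    · exact Or.inr ha
    · have := π.injective (ha.trans (h b).symm)
      exact absurd (Fin.succ_injective _ this.symm) (Fin.succ_ne_zero _)
  have h01 : π 0 ≠ π 1 := fun h => by simpa using π.injective h
  rcases h0 with h0 | h0
  · left
    have h1 : π 1 = 1 := h1.resolve_left fun h => h01 (h0.trans h.symm)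
    ext i
    refine Fin.cases ?_ (fun i => ?_) i
    · simp [h0]
    refine Fin.cases ?_ (fun i => ?_) i
    · simp [h1]
    · simp [h i]
  · right
    have h1 : π 1 = 0 := h1.resolve_right fun h => h01 (h0.trans h.symm)
    ext i
    refine Fin.cases ?_ (fun i => ?_) i
    · simp [h0]
    refine Fin.cases ?_ (fun i => ?_) i
    · simp [h1]
    · rw [h i, Equiv.swap_apply_of_ne_of_ne (Fin.succ_ne_zero _)]
      exact fun h => Fin.succ_ne_zero i (Fin.succ_injective _ h)

theorem sum_offDiag_comp_perm {ι M : Type*} [Fintype ι] [DecidableEq ι] [AddCommMonoid M]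
    (σ : Equiv.Perm ι) (g : ι → ι → M) :
    ∑ i, ∑ j ∈ Finset.univ.erase i, g (σ i) (σ j) = ∑ k, ∑ l ∈ Finset.univ.erase k, g k l := by
  rw [← Equiv.sum_comp σ fun k => ∑ l ∈ Finset.univ.erase k, g k l]
  refine Finset.sum_congr rfl fun i _ => ?_
  refine Finset.sum_bij (fun j _ => σ j) ?_ ?_ ?_ ?_
  · intro j hj
    simpa using hj
  · intro a _ b _ h
    exact σ.injective h
  · intro l hl
    refine ⟨σ.symm l, ?_, by simp⟩
    rw [Finset.mem_erase] at hl ⊢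
    exact ⟨fun h => hl.1 (by rw [← h]; simp), Finset.mem_univ _⟩
  · intro j _
    rfl

/-- Averaging over permutations: `(σ 0, σ 1)` is a uniform pair of distinct indices. -/
theorem sum_perm_apply_zero_one {p : ℕ} (g : Fin (p + 2) → Fin (p + 2) → ℝ) :
    ((p : ℝ) + 2) * ((p : ℝ) + 1) * ∑ σ : Equiv.Perm (Fin (p + 2)), g (σ 0) (σ 1) =
      ((p + 2)! : ℝ) * ∑ k, ∑ l ∈ Finset.univ.erase k, g k l := by
  have h1 : ∀ i : Fin (p + 2), ∀ j ∈ Finset.univ.erase i,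
      ∑ σ : Equiv.Perm (Fin (p + 2)), g (σ i) (σ j) =
        ∑ σ : Equiv.Perm (Fin (p + 2)), g (σ 0) (σ 1) := by
    intro i j hj
    obtain ⟨τ, rfl, rfl⟩ := exists_perm_zero_one (Finset.ne_of_mem_erase hj).symm
    exact Equiv.sum_comp (Equiv.mulRight τ) fun σ : Equiv.Perm (Fin (p + 2)) => g (σ 0) (σ 1)
  have h3 : ∑ i : Fin (p + 2), ∑ j ∈ Finset.univ.erase i,
      ∑ σ : Equiv.Perm (Fin (p + 2)), g (σ i) (σ j) =
      ((p : ℝ) + 2) * ((p : ℝ) + 1) * ∑ σ : Equiv.Perm (Fin (p + 2)), g (σ 0) (σ 1) := by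
    rw [Finset.sum_congr rfl fun i _ => Finset.sum_congr rfl (h1 i)]
    simp [Finset.card_erase_of_mem]
    ring
  rw [← h3]
  simp only [Finset.sum_comm (t := (Finset.univ : Finset (Equiv.Perm (Fin (p + 2)))))]
  rw [Finset.sum_congr rfl fun σ _ => sum_offDiag_comp_perm σ g]
  rw [Finset.sum_const, Finset.card_univ, Fintype.card_perm, Fintype.card_fin, nsmul_eq_mul]

end Permutations

/-! ### Integrating out a squared determinant -/

section IntegratingOut

/-- Integrating out all but two variables of the square of a determinant of orthogonal functions:
in the expansion `∑ σ τ` only `τ = σ` and `τ = σ ∘ (0 1)` survive. -/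
theorem integral_det_sq_cons_cons {p : ℕ} (ρ : Measure ℝ) [SigmaFinite ρ]
    {f : Fin (p + 2) → ℝ → ℝ} {h : Fin (p + 2) → ℝ} (hh : ∀ k, h k ≠ 0)
    (hint : ∀ k l, Integrable (fun x => f k x * f l x) ρ)
    (horth : ∀ k l, ∫ x, f k x * f l x ∂ρ = if k = l then h k else 0) (x y : ℝ) :
    Integrable (fun z : Fin p → ℝ => (Matrix.of fun i j : Fin (p + 2) =>
        f j ((Fin.cons x (Fin.cons y z : Fin (p + 1) → ℝ) : Fin (p + 2) → ℝ) i)).det ^ 2)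
      (Measure.pi fun _ => ρ) ∧
    ∫ z : Fin p → ℝ, (Matrix.of fun i j : Fin (p + 2) =>
        f j ((Fin.cons x (Fin.cons y z : Fin (p + 1) → ℝ) : Fin (p + 2) → ℝ) i)).det ^ 2
      ∂(Measure.pi fun _ => ρ) =
      ((p + 2)! : ℝ) / (((p : ℝ) + 2) * ((p : ℝ) + 1)) * (∏ k, h k) *
        ∑ k, ∑ l ∈ Finset.univ.erase k, (h k)⁻¹ * (h l)⁻¹ *
          ((f k x * f l y) ^ 2 - f k x * f l x * f k y * f l y) := by
  have hexp : (fun z : Fin p → ℝ => (Matrix.of fun i j : Fin (p + 2) =>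
        f j ((Fin.cons x (Fin.cons y z : Fin (p + 1) → ℝ) : Fin (p + 2) → ℝ) i)).det ^ 2) =
      fun z => ∑ σ : Equiv.Perm (Fin (p + 2)), ∑ τ : Equiv.Perm (Fin (p + 2)),
        (((Equiv.Perm.sign σ : ℤ) : ℝ) * ((Equiv.Perm.sign τ : ℤ) : ℝ) *
          (f (σ 0) x * f (τ 0) x) * (f (σ 1) y * f (τ 1) y)) *
          ∏ i : Fin p, (f (σ i.succ.succ) (z i) * f (τ i.succ.succ) (z i)) := by
    funext z
    rw [sq, det_eq_sum_sign_mul_prod, Finset.sum_mul_sum]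
    refine Finset.sum_congr rfl fun σ _ => Finset.sum_congr rfl fun τ _ => ?_
    simp only [Matrix.of_apply, Fin.prod_univ_succ, Fin.cons_zero, Fin.cons_succ,
      Finset.prod_mul_distrib, Fin.succ_zero_eq_one]
    ring
  have hi : ∀ σ τ : Equiv.Perm (Fin (p + 2)), Integrable (fun z : Fin p → ℝ =>
      (((Equiv.Perm.sign σ : ℤ) : ℝ) * ((Equiv.Perm.sign τ : ℤ) : ℝ) *
          (f (σ 0) x * f (τ 0) x) * (f (σ 1) y * f (τ 1) y)) *
          ∏ i : Fin p, (f (σ i.succ.succ) (z i) * f (τ i.succ.succ) (z i)))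
      (Measure.pi fun _ => ρ) := fun σ τ =>
    (Integrable.fintype_prod (f := fun (i : Fin p) t => f (σ i.succ.succ) t * f (τ i.succ.succ) t)
      fun i => hint _ _).const_mul _
  rw [hexp]
  refine ⟨integrable_finsetSum _ fun σ _ => integrable_finsetSum _ fun τ _ => hi σ τ, ?_⟩
  rw [integral_finsetSum _ fun σ _ => integrable_finsetSum _ fun τ _ => hi σ τ]
  simp only [integral_finsetSum _ fun τ _ => hi _ τ, integral_const_mul]
  have hprod : ∀ σ τ : Equiv.Perm (Fin (p + 2)),
      ∫ z : Fin p → ℝ, ∏ i : Fin p, (f (σ i.succ.succ) (z i) * f (τ i.succ.succ) (z i))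
        ∂(Measure.pi fun _ => ρ) =
      ∏ i : Fin p, if σ i.succ.succ = τ i.succ.succ then h (σ i.succ.succ) else 0 := by
    intro σ τ
    rw [integral_fintype_prod_eq_prod
      (fun (i : Fin p) t => f (σ i.succ.succ) t * f (τ i.succ.succ) t)]
    exact Finset.prod_congr rfl fun i _ => horth _ _
  simp only [hprod]
  have hinner : ∀ σ : Equiv.Perm (Fin (p + 2)), ∑ τ : Equiv.Perm (Fin (p + 2)),
      (((Equiv.Perm.sign σ : ℤ) : ℝ) * ((Equiv.Perm.sign τ : ℤ) : ℝ) *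
          (f (σ 0) x * f (τ 0) x) * (f (σ 1) y * f (τ 1) y)) *
          (∏ i : Fin p, if σ i.succ.succ = τ i.succ.succ then h (σ i.succ.succ) else 0) =
      (∏ k, h k) * ((h (σ 0))⁻¹ * (h (σ 1))⁻¹ * ((f (σ 0) x * f (σ 1) y) ^ 2 -
        f (σ 0) x * f (σ 1) x * f (σ 0) y * f (σ 1) y)) := by
    intro σ
    have hh2 : ∏ i : Fin p, h (σ i.succ.succ) = (∏ k, h k) * ((h (σ 0))⁻¹ * (h (σ 1))⁻¹) := by
      rw [← Equiv.prod_comp σ h, Fin.prod_univ_succ, Fin.prod_univ_succ, Fin.succ_zero_eq_one]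
      field_simp [hh (σ 0), hh (σ 1)]
    have hsign : ((Equiv.Perm.sign σ : ℤ) : ℝ) * ((Equiv.Perm.sign σ : ℤ) : ℝ) = 1 := by
      rcases Int.units_eq_one_or (Equiv.Perm.sign σ) with h | h <;> simp [h]
    have h01 : (0 : Fin (p + 2)) ≠ 1 := by simp
    -- with `τ = σ ∘ π`, only the `π` that fix all indices from `2` on contribute
    rw [← Equiv.sum_comp (Equiv.mulLeft σ)]
    simp only [Equiv.coe_mulLeft, Equiv.Perm.mul_apply, σ.injective.eq_iff]
    rw [Fintype.sum_eq_add (1 : Equiv.Perm (Fin (p + 2))) (Equiv.swap 0 1)]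
    · have hsw : ∀ i : Fin p, Equiv.swap (0 : Fin (p + 2)) 1 i.succ.succ = i.succ.succ := fun i =>
        Equiv.swap_apply_of_ne_of_ne (Fin.succ_ne_zero _)
          fun h => Fin.succ_ne_zero i (Fin.succ_injective _ h)
      simp only [mul_one, Equiv.Perm.coe_one, id_eq, if_true, hsw, hh2,
        Equiv.swap_apply_left, Equiv.swap_apply_right, Equiv.Perm.sign_mul,
        Equiv.Perm.sign_swap h01, Units.val_neg, mul_neg, Int.cast_neg]
      linear_combination ((∏ k, h k) * ((h (σ 0))⁻¹ * (h (σ 1))⁻¹) * ((f (σ 0) x * f (σ 1) y) ^ 2 -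
        f (σ 0) x * f (σ 1) x * f (σ 0) y * f (σ 1) y)) * hsign
    · intro h
      have := congrArg (fun π : Equiv.Perm (Fin (p + 2)) => π 0) h
      simp at this
    · intro π hπ
      obtain ⟨i, hi⟩ : ∃ i : Fin p, π i.succ.succ ≠ i.succ.succ := by
        by_contra! hall
        rcases perm_eq_one_or_swap hall with h | h
        · exact hπ.1 h
        · exact hπ.2 h
      rw [Finset.prod_eq_zero (Finset.mem_univ i) (if_neg hi.symm), mul_zero]
  rw [Finset.sum_congr rfl fun σ _ => hinner σ, ← Finset.mul_sum]
  have hcomb := sum_perm_apply_zero_one fun k l : Fin (p + 2) => (h k)⁻¹ * (h l)⁻¹ *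
    ((f k x * f l y) ^ 2 - f k x * f l x * f k y * f l y)
  have hp : ((p : ℝ) + 2) * ((p : ℝ) + 1) ≠ 0 := by positivity
  rw [div_mul_eq_mul_div, div_mul_eq_mul_div, eq_div_iff hp]
  linear_combination (∏ k, h k) * hcomb

end IntegratingOut

/-! ### Symmetrization -/

section Symmetrization

theorem measurePreserving_comp_perm {m : ℕ} (ρ : Measure ℝ) [SigmaFinite ρ]
    (σ : Equiv.Perm (Fin m)) :
    MeasurePreserving (fun x : Fin m → ℝ => x ∘ σ) (Measure.pi fun _ => ρ)
      (Measure.pi fun _ => ρ) := by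
  have h := measurePreserving_piCongrLeft (fun _ : Fin m => ρ) σ.symm
  have he : (fun x : Fin m → ℝ => x ∘ σ) = MeasurableEquiv.piCongrLeft (fun _ => ℝ) σ.symm := by
    funext x i
    have := MeasurableEquiv.piCongrLeft_apply_apply (β := fun _ : Fin m => ℝ) σ.symm x (σ i)
    simpa using this.symm
  rw [he]
  exact h

/-- The vectors with two equal entries lie on finitely many hyperplanes. -/
theorem ae_injective_volume {m : ℕ} : ∀ᵐ x : Fin m → ℝ, Function.Injective x := by
  have h : ∀ i j : Fin m, i ≠ j → ∀ᵐ x : Fin m → ℝ, x i ≠ x j := by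
    intro i j hij
    set s : Submodule ℝ (Fin m → ℝ) :=
      LinearMap.ker ((LinearMap.proj i : (Fin m → ℝ) →ₗ[ℝ] ℝ) - LinearMap.proj j) with hs
    have hne : s ≠ ⊤ := by
      intro h
      have : (Pi.single i 1 : Fin m → ℝ) ∈ s := by rw [h]; trivial
      rw [hs, LinearMap.mem_ker] at this
      simp [hij.symm] at this
    have h0 := Measure.addHaar_submodule (volume : Measure (Fin m → ℝ)) s hne
    rw [ae_iff]
    refine measure_mono_null (fun x hx => ?_) h0
    have hx' : x i = x j := by simpa using hx
    simp [hs, hx']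
  have h' : ∀ᵐ x : Fin m → ℝ, ∀ i j : Fin m, i ≠ j → x i ≠ x j := by
    refine ae_all_iff.2 fun i => ae_all_iff.2 fun j => ?_
    by_cases hij : i = j
    · exact Filter.Eventually.of_forall fun _ h => absurd hij h
    · filter_upwards [h i j hij] with x hx _ using hx
  filter_upwards [h'] with x hx i j hij
  by_contra hne
  exact hx i j hne hij

theorem pi_gammaLaw (ν m : ℕ) : (Measure.pi fun _ : Fin m => gammaLaw ν) =
    volume.withDensity fun x : Fin m → ℝ => ∏ i, gammaDensity ν (x i) := by
  have : SigmaFinite ((volume : Measure ℝ).withDensity (gammaDensity ν)) :=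
    inferInstanceAs (SigmaFinite (gammaLaw ν))
  unfold gammaLaw
  have h := pi_withDensity (n := m) (fun _ : Fin m => (volume : Measure ℝ))
    (fun _ => measurable_gammaDensity ν)
  rw [h, volume_pi]

theorem measurableSet_strictMono {m : ℕ} : MeasurableSet {x : Fin m → ℝ | StrictMono x} := by
  have h : {x : Fin m → ℝ | StrictMono x} = ⋂ i, ⋂ j, {x | i < j → x i < x j} := by
    ext x
    simp [StrictMono]
  rw [h]
  refine MeasurableSet.iInter fun i => MeasurableSet.iInter fun j => ?_
  by_cases hij : i < j
  · simp only [hij, true_imp_iff]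
    exact measurableSet_lt (by fun_prop) (by fun_prop)
  · simp [hij]

/-- The integral of a symmetric function is `m!` times its integral over the chamber of increasing
vectors. -/
theorem lintegral_symmetric (ν : ℕ) {m : ℕ} {F : (Fin m → ℝ) → ENNReal} (hF : Measurable F)
    (hsymm : ∀ (σ : Equiv.Perm (Fin m)) x, F (x ∘ σ) = F x) :
    ∫⁻ x, F x ∂(Measure.pi fun _ : Fin m => gammaLaw ν) =
      (m ! : ENNReal) * ∫⁻ x, {x : Fin m → ℝ | StrictMono x}.indicator F x
        ∂(Measure.pi fun _ : Fin m => gammaLaw ν) := by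
  have hind : Measurable ({x : Fin m → ℝ | StrictMono x}.indicator F) :=
    hF.indicator measurableSet_strictMono
  have hcomp : ∀ σ : Equiv.Perm (Fin m), Measurable fun x : Fin m → ℝ =>
      {x : Fin m → ℝ | StrictMono x}.indicator F (x ∘ σ) := fun σ =>
    hind.comp (measurePreserving_comp_perm (gammaLaw ν) σ).measurable
  have hinj : ∀ᵐ x ∂(Measure.pi fun _ : Fin m => gammaLaw ν), Function.Injective x := by
    rw [pi_gammaLaw]
    exact (withDensity_absolutelyContinuous _ _).ae_le ae_injective_volume
  have h1 : ∀ᵐ x ∂(Measure.pi fun _ : Fin m => gammaLaw ν), F x =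
      ∑ σ : Equiv.Perm (Fin m), {x : Fin m → ℝ | StrictMono x}.indicator F (x ∘ σ) := by
    filter_upwards [hinj] with x hx
    have hmono := Tuple.monotone_sort x
    -- exactly one rearrangement of `x` is increasing
    rw [Finset.sum_eq_single (Tuple.sort x)]
    · rw [Set.indicator_of_mem, hsymm]
      exact hmono.strictMono_of_injective (hx.comp (Equiv.injective _))
    · intro σ _ hσ
      refine Set.indicator_of_notMem (fun h => hσ ?_) _
      have h : StrictMono (x ∘ σ) := by simpa using h
      have := Tuple.unique_monotone h.monotone hmono
      exact Equiv.ext fun i => hx (congrFun this i)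
    · exact fun h => absurd (Finset.mem_univ _) h
  rw [lintegral_congr_ae h1, lintegral_finsetSum _ fun σ _ => hcomp σ]
  rw [Finset.sum_congr rfl fun σ _ => (measurePreserving_comp_perm (gammaLaw ν) σ).lintegral_comp hind]
  simp [Fintype.card_perm]

end Symmetrization

/-! ### The density of a pair of eigenvalues -/

section PairDensity

/-- The squared norm of `L_k^ν` with respect to the Gamma distribution. -/
noncomputable def laguerreNormSq (ν k : ℕ) : ℝ := ((k + ν)! : ℝ) / ((k ! : ℝ) * (ν ! : ℝ))

theorem laguerreNormSq_pos (ν k : ℕ) : 0 < laguerreNormSq ν k := by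
  unfold laguerreNormSq
  positivity

/-- The density of the ordered eigenvalues is, up to its constant, the squared determinant of the
orthonormalized Laguerre polynomials on the increasing vectors. -/
theorem orderedDensity_eq (ν m : ℕ) (x : Fin m → ℝ) :
    orderedDensity ν (laguerreConst (ν + m) m) x =
      ((fun x : Fin m → ℝ => ∏ i, gammaDensity ν (x i)) *
        {x : Fin m → ℝ | StrictMono x}.indicator fun x =>
          ENNReal.ofReal ((∏ k : Fin m, laguerreNormSq ν k)⁻¹ *
            (Matrix.of fun i j : Fin m => laguerreL ν j (x i)).det ^ 2)) x := by
  have hconst : laguerreConst (ν + m) m * (ν ! : ℝ) ^ m * (∏ j : Fin m, (((j : ℕ)! : ℝ)) ^ 2) =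
      (∏ k : Fin m, laguerreNormSq ν k)⁻¹ := by
    rw [Fin.prod_univ_eq_prod_range (fun j => ((j ! : ℝ)) ^ 2) m,
      Fin.prod_univ_eq_prod_range (fun j => laguerreNormSq ν j) m, laguerreConst]
    refine eq_inv_of_mul_eq_one_left ?_
    have h1 : (ν ! : ℝ) ^ m = ∏ j ∈ Finset.range m, (ν ! : ℝ) := by simp
    rw [h1, ← Finset.prod_mul_distrib, ← Finset.prod_mul_distrib, ← Finset.prod_mul_distrib]
    have h2 : ∀ j ∈ Finset.range m, ((j ! : ℝ) * ((ν + m - 1 - j)! : ℝ))⁻¹ * (ν ! : ℝ) *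
        (j ! : ℝ) ^ 2 * laguerreNormSq ν j =
        ((j + ν)! : ℝ) * (((m - 1 - j + ν)! : ℝ))⁻¹ := by
      intro j hj
      have := Finset.mem_range.1 hj
      rw [show ν + m - 1 - j = m - 1 - j + ν by omega, laguerreNormSq]
      have h1 : (j ! : ℝ) ≠ 0 := by positivity
      have h2 : (ν ! : ℝ) ≠ 0 := by positivity
      field_simp
    rw [Finset.prod_congr rfl h2, Finset.prod_mul_distrib,
      Finset.prod_range_reflect (fun j => (((j + ν)! : ℝ))⁻¹) m, ← Finset.prod_mul_distrib]
    exact Finset.prod_eq_one fun j _ => mul_inv_cancel₀ (by positivity)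
  rw [Pi.mul_apply]
  by_cases hpos : ∀ i, 0 < x i
  swap
  · rw [orderedDensity_of_notMem fun h => hpos h.2]
    obtain ⟨i, hi⟩ := not_forall.1 hpos
    rw [Finset.prod_eq_zero (Finset.mem_univ i) (gammaDensity_of_nonpos (not_lt.1 hi)), zero_mul]
  by_cases hm : StrictMono x
  swap
  · rw [orderedDensity_of_notMem fun h => hm h.1, Set.indicator_of_notMem (by simpa using hm),
      mul_zero]
  rw [orderedDensity_of_mem ⟨hm, hpos⟩, Set.indicator_of_mem (by simpa using hm),
    Finset.prod_congr rfl fun i _ => gammaDensity_of_pos (hpos i),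
    ← ENNReal.ofReal_prod_of_nonneg fun i _ => by have := hpos i; positivity,
    ← ENNReal.ofReal_mul (Finset.prod_nonneg fun i _ => by have := hpos i; positivity),
    ← hconst, det_laguerreL]
  congr 1
  have h3 : (∏ j : Fin m, ((-1 : ℝ) ^ (j : ℕ) / ((j : ℕ)! : ℝ))) ^ 2 *
      ∏ j : Fin m, (((j : ℕ)! : ℝ)) ^ 2 = 1 := by
    rw [← Finset.prod_pow, ← Finset.prod_mul_distrib]
    refine Finset.prod_eq_one fun j _ => ?_
    rw [← mul_pow, div_mul_cancel₀ _ (by positivity), ← pow_mul, mul_comm, pow_mul]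
    simp
  have h4 : ∏ i, (x i ^ ν * Real.exp (-x i) / (ν ! : ℝ)) * (ν ! : ℝ) =
      ∏ i, (x i ^ ν * Real.exp (-x i)) :=
    Finset.prod_congr rfl fun i _ => div_mul_cancel₀ _ (by positivity)
  rw [Finset.prod_mul_distrib] at h4
  simp only [Finset.prod_const, Finset.card_univ, Fintype.card_fin] at h4
  rw [← h4]
  linear_combination (-laguerreConst (ν + m) m * (Matrix.vandermonde x).det ^ 2 *
    ((∏ i, (x i ^ ν * Real.exp (-x i) / (ν ! : ℝ))) * (ν ! : ℝ) ^ m)) * h3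

theorem sum_range_erase_eq_sum_fin {m : ℕ} (g : ℕ → ℕ → ℝ) :
    ∑ k ∈ Finset.range m, ∑ l ∈ (Finset.range m).erase k, g k l =
      ∑ k : Fin m, ∑ l ∈ Finset.univ.erase k, g k l := by
  rw [← Fin.sum_univ_eq_sum_range (fun k => ∑ l ∈ (Finset.range m).erase k, g k l)]
  refine Finset.sum_congr rfl fun k _ => ?_
  rw [Finset.sum_erase_eq_sub (Finset.mem_range.2 k.2), Finset.sum_erase_eq_sub (Finset.mem_univ k),
    ← Fin.sum_univ_eq_sum_range (fun l => g k l)]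

/-- Exchanging `k` and `l` and adding turns the summands into squares of `2 × 2` determinants. -/
theorem eigenvaluePairDensity_nonneg {m ν : ℕ} (hm : 2 ≤ m) {x y : ℝ} (hx : 0 < x) (hy : 0 < y) :
    0 ≤ eigenvaluePairDensity m ν x y := by
  have hm' : (2 : ℝ) ≤ m := by exact_mod_cast hm
  refine mul_nonneg (div_nonneg (by positivity) (mul_nonneg (by linarith) (by linarith))) ?_
  set t : ℕ → ℕ → ℝ := fun k l => ((k ! : ℝ) * (l ! : ℝ)) / (((k + ν)! : ℝ) * ((l + ν)! : ℝ)) *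
        ((laguerreL ν k x * laguerreL ν l y) ^ 2 -
          laguerreL ν k x * laguerreL ν l x * laguerreL ν k y * laguerreL ν l y) with ht
  show 0 ≤ ∑ k ∈ Finset.range m, ∑ l ∈ (Finset.range m).erase k, t k l
  have h1 : ∑ k ∈ Finset.range m, ∑ l ∈ (Finset.range m).erase k, t k l =
      ∑ k ∈ Finset.range m, ∑ l ∈ Finset.range m, t k l :=
    Finset.sum_congr rfl fun k _ => Finset.sum_erase _ (by simp only [ht]; ring)
  have h2 : 2 * ∑ k ∈ Finset.range m, ∑ l ∈ Finset.range m, t k l =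
      ∑ k ∈ Finset.range m, ∑ l ∈ Finset.range m, (t k l + t l k) := by
    simp only [Finset.sum_add_distrib]
    rw [Finset.sum_comm (f := fun k l => t l k)]
    ring
  have h3 : 0 ≤ ∑ k ∈ Finset.range m, ∑ l ∈ Finset.range m, (t k l + t l k) := by
    refine Finset.sum_nonneg fun k _ => Finset.sum_nonneg fun l _ => ?_
    have : t k l + t l k = ((k ! : ℝ) * (l ! : ℝ)) / (((k + ν)! : ℝ) * ((l + ν)! : ℝ)) *
        (laguerreL ν k x * laguerreL ν l y - laguerreL ν l x * laguerreL ν k y) ^ 2 := by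
      simp only [ht]
      rw [mul_comm (l ! : ℝ), mul_comm ((l + ν)! : ℝ)]
      ring
    rw [this]
    positivity
  rw [h1]
  linarith

theorem measurable_laguerreL (ν k : ℕ) : Measurable (laguerreL ν k) := by
  unfold laguerreL
  fun_prop

theorem measurable_det_laguerreL (ν m : ℕ) : Measurable fun x : Fin m → ℝ =>
    (Matrix.of fun i j : Fin m => laguerreL ν j (x i)).det := by
  simp only [det_laguerreL]
  exact continuous_det_vandermonde.measurable.mul_const _

/-- The measure on `ℝ × ℝ` with density `eigenvaluePairDensity m ν` on the open positive quadrant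
and `0` elsewhere. -/
noncomputable def pairLaw (m ν : ℕ) : Measure (ℝ × ℝ) :=
  (volume : Measure (ℝ × ℝ)).withDensity
    ({p : ℝ × ℝ | 0 < p.1 ∧ 0 < p.2}.indicator
      fun p => ENNReal.ofReal (eigenvaluePairDensity m ν p.1 p.2))

/-- The squared Laguerre determinant with all but two variables integrated out, times the two
remaining Gamma densities, is `m!` times the density of the pair, for `m = p + 2`. -/
theorem gammaDensity_mul_ofReal_eq (p ν : ℕ) (q : ℝ × ℝ) :
    gammaDensity ν q.1 * gammaDensity ν q.2 * ENNReal.ofReal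
      ((∏ k : Fin (p + 2), laguerreNormSq ν k)⁻¹ *
        (((p + 2)! : ℝ) / (((p : ℝ) + 2) * ((p : ℝ) + 1)) *
          (∏ k : Fin (p + 2), laguerreNormSq ν k) *
          ∑ k : Fin (p + 2), ∑ l ∈ Finset.univ.erase k,
            (laguerreNormSq ν k)⁻¹ * (laguerreNormSq ν l)⁻¹ *
            ((laguerreL ν k q.1 * laguerreL ν l q.2) ^ 2 -
              laguerreL ν k q.1 * laguerreL ν l q.1 * laguerreL ν k q.2 * laguerreL ν l q.2))) =
    ((p + 2)! : ENNReal) * {p : ℝ × ℝ | 0 < p.1 ∧ 0 < p.2}.indicator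
      (fun q => ENNReal.ofReal (eigenvaluePairDensity (p + 2) ν q.1 q.2)) q := by
  by_cases hx : 0 < q.1
  swap
  · rw [gammaDensity_of_nonpos (not_lt.1 hx), Set.indicator_of_notMem (by simp [hx])]
    simp
  by_cases hy : 0 < q.2
  swap
  · rw [gammaDensity_of_nonpos (t := q.2) (not_lt.1 hy), Set.indicator_of_notMem (by simp [hy])]
    simp
  have hP : 0 < ∏ k : Fin (p + 2), laguerreNormSq ν k :=
    Finset.prod_pos fun k _ => laguerreNormSq_pos ν k
  have hfac : ((p + 2)! : ENNReal) = ENNReal.ofReal ((p + 2)! : ℝ) := by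
    rw [ENNReal.ofReal_natCast]
  rw [gammaDensity_of_pos hx, gammaDensity_of_pos hy, Set.indicator_of_mem (by simp [hx, hy]),
    ← ENNReal.ofReal_mul (by positivity), ← ENNReal.ofReal_mul (by positivity), hfac,
    ← ENNReal.ofReal_mul (by positivity)]
  congr 1
  rw [eigenvaluePairDensity, sum_range_erase_eq_sum_fin fun k l =>
    ((k ! : ℝ) * (l ! : ℝ)) / (((k + ν)! : ℝ) * ((l + ν)! : ℝ)) *
        ((laguerreL ν k q.1 * laguerreL ν l q.2) ^ 2 -
          laguerreL ν k q.1 * laguerreL ν l q.1 * laguerreL ν k q.2 * laguerreL ν l q.2)]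
  have hterm : ∀ k l : ℕ, (laguerreNormSq ν k)⁻¹ * (laguerreNormSq ν l)⁻¹ =
      (ν ! : ℝ) ^ 2 * (((k ! : ℝ) * (l ! : ℝ)) / (((k + ν)! : ℝ) * ((l + ν)! : ℝ))) := by
    intro k l
    rw [laguerreNormSq, laguerreNormSq]
    field_simp
  simp only [hterm, mul_assoc ((ν ! : ℝ) ^ 2), ← Finset.mul_sum]
  have hν : (ν ! : ℝ) ≠ 0 := by positivity
  rw [mul_pow, neg_add, Real.exp_add]
  push_cast
  have h1 : (p : ℝ) + 2 - 1 = p + 1 := by ring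
  rw [h1]
  field_simp

/-- Under the product of the Gamma distributions, the first two variables weighted by the squared
Laguerre determinant have `m!` times the law `pairLaw m ν`, for `m = p + 2`. -/
theorem lintegral_det_sq_mul_apply_zero_one (p ν : ℕ) {f : ℝ × ℝ → ENNReal} (hf : Measurable f) :
    ∫⁻ x : Fin (p + 2) → ℝ, f (x 0, x 1) *
        ENNReal.ofReal ((∏ k : Fin (p + 2), laguerreNormSq ν k)⁻¹ *
          (Matrix.of fun i j : Fin (p + 2) => laguerreL ν j (x i)).det ^ 2)
        ∂(Measure.pi fun _ => gammaLaw ν) =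
      ((p + 2)! : ENNReal) * ∫⁻ q, f q ∂pairLaw (p + 2) ν := by
  set B : (Fin (p + 2) → ℝ) → ENNReal := fun x =>
    ENNReal.ofReal ((∏ k : Fin (p + 2), laguerreNormSq ν k)⁻¹ *
          (Matrix.of fun i j : Fin (p + 2) => laguerreL ν j (x i)).det ^ 2) with hB
  have hBm : Measurable B := by
    have := measurable_det_laguerreL ν (p + 2)
    fun_prop
  have hP : 0 < ∏ k : Fin (p + 2), laguerreNormSq ν k :=
    Finset.prod_pos fun k _ => laguerreNormSq_pos ν k
  have hm1 : Measurable fun x : Fin (p + 2) → ℝ => f (x 0, x 1) * B x := by fun_prop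
  have hc1 := measurePreserving_finCons fun _ : Fin (p + 2) => gammaLaw ν
  have hc2 := measurePreserving_finCons fun _ : Fin (p + 1) => gammaLaw ν
  have hE : ∀ x y : ℝ, ∫⁻ z : Fin p → ℝ,
      B (Fin.cons x (Fin.cons y z : Fin (p + 1) → ℝ)) ∂(Measure.pi fun _ => gammaLaw ν) =
      ENNReal.ofReal ((∏ k : Fin (p + 2), laguerreNormSq ν k)⁻¹ *
        (((p + 2)! : ℝ) / (((p : ℝ) + 2) * ((p : ℝ) + 1)) *
          (∏ k : Fin (p + 2), laguerreNormSq ν k) *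
          ∑ k : Fin (p + 2), ∑ l ∈ Finset.univ.erase k,
            (laguerreNormSq ν k)⁻¹ * (laguerreNormSq ν l)⁻¹ *
            ((laguerreL ν k x * laguerreL ν l y) ^ 2 -
              laguerreL ν k x * laguerreL ν l x * laguerreL ν k y * laguerreL ν l y))) := by
    intro x y
    obtain ⟨hi, hv⟩ := integral_det_sq_cons_cons (p := p) (gammaLaw ν)
      (f := fun k => laguerreL ν k) (h := fun k => laguerreNormSq ν k)
      (fun k => (laguerreNormSq_pos ν k).ne') (fun k l => integrable_laguerreL_mul ν k l)
      (fun k l => by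
        rw [integral_laguerreL_mul]
        simp only [Fin.ext_iff, laguerreNormSq]) x y
    rw [← hv, ← integral_const_mul, ofReal_integral_eq_lintegral_ofReal (hi.const_mul _)]
    exact Filter.Eventually.of_forall fun z => mul_nonneg (inv_nonneg.2 hP.le) (sq_nonneg _)
  rw [← hc1.lintegral_comp hm1, 
    lintegral_prod (fun q : ℝ × (Fin (p + 1) → ℝ) => f ((Fin.cons q.1 q.2 : Fin (p + 2) → ℝ) 0,
      (Fin.cons q.1 q.2 : Fin (p + 2) → ℝ) 1) * B (Fin.cons q.1 q.2))
      (hm1.comp hc1.measurable).aemeasurable]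
  have hinner : ∀ x : ℝ, ∫⁻ w : Fin (p + 1) → ℝ,
      f ((Fin.cons x w : Fin (p + 2) → ℝ) 0, (Fin.cons x w : Fin (p + 2) → ℝ) 1) *
        B (Fin.cons x w) ∂(Measure.pi fun _ => gammaLaw ν) =
      ∫⁻ y, f (x, y) * ∫⁻ z : Fin p → ℝ, B (Fin.cons x (Fin.cons y z : Fin (p + 1) → ℝ))
        ∂(Measure.pi fun _ => gammaLaw ν) ∂gammaLaw ν := by
    intro x
    have hm2 : Measurable fun w : Fin (p + 1) → ℝ =>
        f ((Fin.cons x w : Fin (p + 2) → ℝ) 0, (Fin.cons x w : Fin (p + 2) → ℝ) 1) *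
        B (Fin.cons x w) :=
      hm1.comp (hc1.measurable.comp (measurable_prodMk_left (x := x)))
    rw [← hc2.lintegral_comp hm2, 
      lintegral_prod (fun q : ℝ × (Fin p → ℝ) =>
        f ((Fin.cons x (Fin.cons q.1 q.2 : Fin (p + 1) → ℝ) : Fin (p + 2) → ℝ) 0,
          (Fin.cons x (Fin.cons q.1 q.2 : Fin (p + 1) → ℝ) : Fin (p + 2) → ℝ) 1) *
        B (Fin.cons x (Fin.cons q.1 q.2 : Fin (p + 1) → ℝ)))
        (hm2.comp hc2.measurable).aemeasurable]
    refine lintegral_congr fun y => ?_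
    rw [← lintegral_const_mul]
    · rfl
    · exact hBm.comp (hc1.measurable.comp ((measurable_prodMk_left (x := x)).comp
        (hc2.measurable.comp (measurable_prodMk_left (x := y)))))
  simp only [hinner, hE]
  set Q : ℝ × ℝ → ENNReal := fun q => ENNReal.ofReal ((∏ k : Fin (p + 2), laguerreNormSq ν k)⁻¹ *
        (((p + 2)! : ℝ) / (((p : ℝ) + 2) * ((p : ℝ) + 1)) *
          (∏ k : Fin (p + 2), laguerreNormSq ν k) *
          ∑ k : Fin (p + 2), ∑ l ∈ Finset.univ.erase k,
            (laguerreNormSq ν k)⁻¹ * (laguerreNormSq ν l)⁻¹ *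
            ((laguerreL ν k q.1 * laguerreL ν l q.2) ^ 2 -
              laguerreL ν k q.1 * laguerreL ν l q.1 * laguerreL ν k q.2 * laguerreL ν l q.2)))
    with hQ
  have hL := measurable_laguerreL ν
  have hQm : Measurable Q := by fun_prop
  have hD : Measurable ({p : ℝ × ℝ | 0 < p.1 ∧ 0 < p.2}.indicator
      (fun q => ENNReal.ofReal (eigenvaluePairDensity (p + 2) ν q.1 q.2))) := by
    have h1 : MeasurableSet {p : ℝ × ℝ | 0 < p.1} := measurableSet_lt (by fun_prop) (by fun_prop)
    have h2 : MeasurableSet {p : ℝ × ℝ | 0 < p.2} := measurableSet_lt (by fun_prop) (by fun_prop)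
    refine Measurable.indicator ?_ (h1.inter h2)
    unfold eigenvaluePairDensity
    fun_prop
  calc ∫⁻ x, ∫⁻ y, f (x, y) * Q (x, y) ∂gammaLaw ν ∂gammaLaw ν
      = ∫⁻ q, f q * Q q ∂(gammaLaw ν).prod (gammaLaw ν) :=
        (lintegral_prod (fun q => f q * Q q) (hf.mul hQm).aemeasurable).symm
    _ = ∫⁻ q : ℝ × ℝ, gammaDensity ν q.1 * gammaDensity ν q.2 * (f q * Q q) := by
        rw [gammaLaw, prod_withDensity (by fun_prop) (by fun_prop),
          lintegral_withDensity_eq_lintegral_mul _ (by fun_prop)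
            (show Measurable fun q => f q * Q q from hf.mul hQm), Measure.volume_eq_prod]
        rfl
    _ = ∫⁻ q : ℝ × ℝ, ((p + 2)! : ENNReal) * ({p : ℝ × ℝ | 0 < p.1 ∧ 0 < p.2}.indicator
          (fun q => ENNReal.ofReal (eigenvaluePairDensity (p + 2) ν q.1 q.2)) q * f q) := by
        refine lintegral_congr fun q => ?_
        rw [← mul_assoc _ _ (f q), ← gammaDensity_mul_ofReal_eq]
        simp only [hQ]
        ring
    _ = ((p + 2)! : ENNReal) * ∫⁻ q, f q ∂pairLaw (p + 2) ν := by
        rw [lintegral_const_mul _ (show Measurable fun q => _ * f q from hD.mul hf), pairLaw,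
          lintegral_withDensity_eq_lintegral_mul _ hD hf]
        rfl

/-- The expectation of a sum over the ordered pairs of distinct eigenvalues. The sum is symmetric, so
the ordering of the eigenvalues can be dropped, and then each pair contributes the same. -/
theorem sum_lintegral_orderedDensity (p ν : ℕ) {f : ℝ × ℝ → ENNReal} (hf : Measurable f) :
    ∫⁻ x : Fin (p + 2) → ℝ, (∑ i, ∑ j ∈ Finset.univ.erase i, f (x i, x j))
        ∂(volume.withDensity (orderedDensity ν (laguerreConst (ν + (p + 2)) (p + 2)))) =
      (((p + 2) * (p + 1) : ℕ) : ENNReal) * ∫⁻ q, f q ∂pairLaw (p + 2) ν := by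
  set B : (Fin (p + 2) → ℝ) → ENNReal := fun x =>
    ENNReal.ofReal ((∏ k : Fin (p + 2), laguerreNormSq ν k)⁻¹ *
          (Matrix.of fun i j : Fin (p + 2) => laguerreL ν j (x i)).det ^ 2) with hB
  have hBm : Measurable B := by
    have := measurable_det_laguerreL ν (p + 2)
    fun_prop
  have hBsymm : ∀ (σ : Equiv.Perm (Fin (p + 2))) x, B (x ∘ σ) = B x := by
    intro σ x
    have h1 := Matrix.det_permute σ (Matrix.of fun i j : Fin (p + 2) => laguerreL ν j (x i))
    have h2 : ((Equiv.Perm.sign σ : ℤ) : ℝ) ^ 2 = 1 := by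
      rcases Int.units_eq_one_or (Equiv.Perm.sign σ) with h | h <;> simp [h]
    have h3 : (Matrix.of fun i j : Fin (p + 2) => laguerreL ν j ((x ∘ σ) i)) =
        (Matrix.of fun i j : Fin (p + 2) => laguerreL ν j (x i)).submatrix σ id := rfl
    simp only [hB]
    rw [h3, h1, mul_pow, h2, one_mul]
  set F : (Fin (p + 2) → ℝ) → ENNReal := fun x => ∑ i, ∑ j ∈ Finset.univ.erase i, f (x i, x j)
    with hFdef
  have hFm : Measurable F := by fun_prop
  have hpairm : ∀ i j : Fin (p + 2), Measurable fun x : Fin (p + 2) → ℝ => f (x i, x j) * B x :=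
    fun i j => by fun_prop
  have hdens : volume.withDensity (orderedDensity ν (laguerreConst (ν + (p + 2)) (p + 2))) =
      (Measure.pi fun _ : Fin (p + 2) => gammaLaw ν).withDensity
        ({x : Fin (p + 2) → ℝ | StrictMono x}.indicator B) := by
    rw [pi_gammaLaw, ← withDensity_mul _ (by fun_prop) (hBm.indicator measurableSet_strictMono)]
    congr 1
    funext x
    exact orderedDensity_eq ν (p + 2) x
  have hsym := lintegral_symmetric ν (F := fun x => F x * B x) (hFm.mul hBm) fun σ x => by
    simp only [hBsymm]
    congr 1
    exact sum_offDiag_comp_perm σ fun i j => f (x i, x j)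
  have hpairs : ∫⁻ x, F x * B x ∂(Measure.pi fun _ : Fin (p + 2) => gammaLaw ν) =
      (((p + 2) * (p + 1) : ℕ) : ENNReal) * (((p + 2)! : ENNReal) *
        ∫⁻ q, f q ∂pairLaw (p + 2) ν) := by
    simp only [hFdef, Finset.sum_mul]
    rw [lintegral_finsetSum _ fun i _ => Finset.measurable_fun_sum _ fun j _ => hpairm i j]
    simp only [lintegral_finsetSum _ fun j _ => hpairm _ j]
    have heach : ∀ i : Fin (p + 2), ∀ j ∈ Finset.univ.erase i,
        ∫⁻ x, f (x i, x j) * B x ∂(Measure.pi fun _ : Fin (p + 2) => gammaLaw ν) =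
          ((p + 2)! : ENNReal) * ∫⁻ q, f q ∂pairLaw (p + 2) ν := by
      intro i j hj
      obtain ⟨τ, rfl, rfl⟩ := exists_perm_zero_one (Finset.ne_of_mem_erase hj).symm
      rw [← lintegral_det_sq_mul_apply_zero_one p ν hf,
        ← (measurePreserving_comp_perm (gammaLaw ν) τ).lintegral_comp (hpairm 0 1)]
      simp only [hBsymm, Function.comp_apply]
    rw [Finset.sum_congr rfl fun i _ => Finset.sum_congr rfl (heach i)]
    simp [Finset.card_erase_of_mem]
    ring
  have hfac0 : ((p + 2)! : ENNReal) ≠ 0 := by exact_mod_cast (Nat.factorial_pos _).ne'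
  rw [hdens, lintegral_withDensity_eq_lintegral_mul _ (hBm.indicator measurableSet_strictMono) hFm]
  refine (ENNReal.mul_right_inj hfac0 (ENNReal.natCast_ne_top _)).1 ?_
  rw [mul_left_comm, ← hpairs, hsym]
  congr 1
  refine lintegral_congr fun x => ?_
  rw [Pi.mul_apply]
  by_cases hx : StrictMono x
  · rw [Set.indicator_of_mem (by simpa using hx), Set.indicator_of_mem (by simpa using hx), mul_comm]
  · rw [Set.indicator_of_notMem (by simpa using hx), Set.indicator_of_notMem (by simpa using hx),
      zero_mul]

end PairDensity

/-! ### A uniformly random pair of eigenvalues -/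

section Probability

theorem lintegral_uniformOn_offDiag (p : ℕ) (h : Fin (p + 2) × Fin (p + 2) → ENNReal) :
    ∫⁻ q, h q ∂(uniformOn {q : Fin (p + 2) × Fin (p + 2) | q.1 ≠ q.2}) =
      ((((p + 2) * (p + 1) : ℕ) : ENNReal))⁻¹ *
        ∑ i, ∑ j ∈ Finset.univ.erase i, h (i, j) := by
  classical
  set S : Set (Fin (p + 2) × Fin (p + 2)) := {q | q.1 ≠ q.2} with hS
  have hSm : MeasurableSet S := S.toFinite.measurableSet
  have hint : ∀ h : Fin (p + 2) × Fin (p + 2) → ENNReal,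
      ∫⁻ q in S, h q ∂Measure.count = ∑ i, ∑ j ∈ Finset.univ.erase i, h (i, j) := by
    intro h
    rw [← lintegral_indicator hSm, lintegral_count, tsum_fintype, Fintype.sum_prod_type]
    refine Finset.sum_congr rfl fun i _ => ?_
    rw [← Finset.sum_erase (Finset.univ) (a := i) (f := fun j => S.indicator h (i, j))]
    · refine Finset.sum_congr rfl fun j hj => Set.indicator_of_mem ?_ _
      simpa [hS] using (Finset.ne_of_mem_erase hj).symm
    · exact Set.indicator_of_notMem (by simp [hS]) _
  have hcard : Measure.count S = (((p + 2) * (p + 1) : ℕ) : ENNReal) := by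
    rw [← setLIntegral_one, hint]
    simp [Finset.card_erase_of_mem]
    ring
  rw [uniformOn, ProbabilityTheory.cond, lintegral_smul_measure, hint, hcard, smul_eq_mul]

theorem measurable_wishartEigenvalues {m n : ℕ} (i : Fin m) :
    Measurable fun A : Fin m → Fin n → ℂ => wishartEigenvalues (Matrix.of A) i := by
  have h : (fun A : Fin m → Fin n → ℂ => wishartEigenvalues (Matrix.of A) i) =
      fun A => ascEig A (ascIndex m i) := funext fun A => by rw [wishartEigenvalues_eq_ascEig]
  rw [h]
  exact measurable_pi_iff.1 measurable_ascEig _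

/-- The law of the eigenvalues with a uniformly random pair of distinct indices. -/
theorem map_wishartEigenvalues_pair {n : ℕ} (p ν : ℕ) (hn : n = ν + (p + 2)) :
    ((uniformOn {q : Fin (p + 2) × Fin (p + 2) | q.1 ≠ q.2}).prod
      (Measure.pi fun _ : Fin (p + 2) => Measure.pi fun _ : Fin n => complexNormal)).map
        (fun w : (Fin (p + 2) × Fin (p + 2)) × (Fin (p + 2) → Fin n → ℂ) =>
          (wishartEigenvalues (Matrix.of w.2) w.1.1, wishartEigenvalues (Matrix.of w.2) w.1.2)) =
      pairLaw (p + 2) ν := by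
  set γ := Measure.pi fun _ : Fin (p + 2) => Measure.pi fun _ : Fin n => complexNormal with hγ
  have hm : Measurable fun w : (Fin (p + 2) × Fin (p + 2)) × (Fin (p + 2) → Fin n → ℂ) =>
      (wishartEigenvalues (Matrix.of w.2) w.1.1, wishartEigenvalues (Matrix.of w.2) w.1.2) :=
    measurable_from_prod_countable_right fun q =>
      (measurable_wishartEigenvalues q.1).prodMk (measurable_wishartEigenvalues q.2)
  refine Measure.ext_of_lintegral _ fun f hf => ?_
  have hfm : ∀ i j : Fin (p + 2), Measurable fun A : Fin (p + 2) → Fin n → ℂ =>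
      f (wishartEigenvalues (Matrix.of A) i, wishartEigenvalues (Matrix.of A) j) := fun i j =>
    hf.comp ((measurable_wishartEigenvalues i).prodMk (measurable_wishartEigenvalues j))
  rw [lintegral_map hf hm, 
    lintegral_prod_symm' (fun w : (Fin (p + 2) × Fin (p + 2)) × (Fin (p + 2) → Fin n → ℂ) =>
      f (wishartEigenvalues (Matrix.of w.2) w.1.1, wishartEigenvalues (Matrix.of w.2) w.1.2))
      (hf.comp hm)]
  simp only [lintegral_uniformOn_offDiag]
  rw [lintegral_const_mul _ (Finset.measurable_fun_sum _ fun i _ =>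
    Finset.measurable_fun_sum _ fun j _ => hfm i j)]
  simp only [wishartEigenvalues_eq_ascEig]
  have hF : Measurable fun x : Fin (p + 2) → ℝ =>
      ∑ i, ∑ j ∈ Finset.univ.erase i, f (x i, x j) := by fun_prop
  have hsum : ∫⁻ A, (∑ i, ∑ j ∈ Finset.univ.erase i,
      f (ascEig A (ascIndex (p + 2) i), ascEig A (ascIndex (p + 2) j))) ∂γ =
      (((p + 2) * (p + 1) : ℕ) : ENNReal) * ∫⁻ q, f q ∂pairLaw (p + 2) ν := by
    rw [← sum_lintegral_orderedDensity p ν hf, ← hn, ← map_ascEig (p + 2) ν hn,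
      lintegral_map hF measurable_ascEig]
    exact lintegral_congr fun A =>
      sum_offDiag_comp_perm (ascIndex (p + 2)) fun i j => f (ascEig A i, ascEig A j)
  rw [hsum, ← mul_assoc, ENNReal.inv_mul_cancel, one_mul]
  · exact_mod_cast (by positivity : (p + 2) * (p + 1) ≠ 0)
  · exact ENNReal.natCast_ne_top _

end Probability

theorem theorem3 {Ω : Type*} [MeasurableSpace Ω] (P : Measure Ω) [IsProbabilityMeasure P]
    (m n : ℕ) (hm : 2 ≤ m) (hmn : m ≤ n)
    -- the random matrix `G = (g i j)`, with i.i.d. standard complex normal entries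
    (g : Fin m → Fin n → Ω → ℂ)
    (hg_law : ∀ i j, HasLaw (g i j) complexNormal P)
    (hg_indep : iIndepFun (fun (p : Fin m × Fin n) => g p.1 p.2) P)
    -- `(I, J)`: a uniformly random ordered pair of distinct indices, independent of `G`
    (I J : Ω → Fin m)
    (hIJ_law : HasLaw (fun ω => (I ω, J ω)) (uniformOn {p : Fin m × Fin m | p.1 ≠ p.2}) P)
    (hIJ_indep : IndepFun (fun ω => (I ω, J ω)) (fun ω i j => g i j ω) P) :
    (∀ x y : ℝ, 0 < x → 0 < y → 0 ≤ eigenvaluePairDensity m (n - m) x y) ∧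
    HasLaw
      (fun ω =>
        (wishartEigenvalues (Matrix.of fun i j => g i j ω) (I ω),
         wishartEigenvalues (Matrix.of fun i j => g i j ω) (J ω)))
      ((volume : Measure (ℝ × ℝ)).withDensity
        ({p : ℝ × ℝ | 0 < p.1 ∧ 0 < p.2}.indicator
          fun p => ENNReal.ofReal (eigenvaluePairDensity m (n - m) p.1 p.2)))
      P := by
  refine ⟨fun x y hx hy => eigenvaluePairDensity_nonneg hm hx hy, ?_⟩
  obtain ⟨p, rfl⟩ : ∃ p, m = p + 2 := ⟨m - 2, by omega⟩
  have hG : HasLaw (fun ω i j => g i j ω)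
      (Measure.pi fun _ : Fin (p + 2) => Measure.pi fun _ : Fin n => complexNormal) P := by
    have h1 := iIndepFun.hasLaw_pi (fun q : Fin (p + 2) × Fin n => hg_law q.1 q.2) hg_indep
    have h2 := Measure.infinitePi_map_curry fun (_ : Fin (p + 2)) (_ : Fin n) => complexNormal
    simp only [Measure.infinitePi_eq_pi] at h2
    exact HasLaw.fun_comp (Y := MeasurableEquiv.curry (Fin (p + 2)) (Fin n) ℂ)
      ⟨(MeasurableEquiv.curry _ _ _).measurable.aemeasurable, h2⟩ h1
  have hjoint : HasLaw (fun ω => ((I ω, J ω), fun i j => g i j ω))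
      ((uniformOn {q : Fin (p + 2) × Fin (p + 2) | q.1 ≠ q.2}).prod
        (Measure.pi fun _ : Fin (p + 2) => Measure.pi fun _ : Fin n => complexNormal)) P := by
    refine ⟨hIJ_law.aemeasurable.prodMk hG.aemeasurable, ?_⟩
    rw [(indepFun_iff_map_prod_eq_prod_map_map hIJ_law.aemeasurable hG.aemeasurable).1 hIJ_indep,
      hIJ_law.map_eq, hG.map_eq]
  have hm' : Measurable fun w : (Fin (p + 2) × Fin (p + 2)) × (Fin (p + 2) → Fin n → ℂ) =>
      (wishartEigenvalues (Matrix.of w.2) w.1.1, wishartEigenvalues (Matrix.of w.2) w.1.2) :=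
    measurable_from_prod_countable_right fun q =>
      (measurable_wishartEigenvalues q.1).prodMk (measurable_wishartEigenvalues q.2)
  exact HasLaw.fun_comp (Y := fun w : (Fin (p + 2) × Fin (p + 2)) × (Fin (p + 2) → Fin n → ℂ) =>
      (wishartEigenvalues (Matrix.of w.2) w.1.1, wishartEigenvalues (Matrix.of w.2) w.1.2))
    ⟨hm'.aemeasurable, map_wishartEigenvalues_pair p (n - (p + 2)) (by omega)⟩ hjoint
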